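/- Let $k$ be an arbitrary field. An endomorphism of $\mathbb{A}^n=\mathbb{A}^n_k$ is a tuple $f=(f_1,\ldots,f_n)$ of polynomials in $k[x_1,\ldots,x_n]$, its degree is $\deg(f)=\max_i\deg(f_i)$, and $\mathrm{Aut}(\mathbb{A}^n)$ is the group of endomorphisms that are invertible for composition. The dynamical degree of $f\in\mathrm{Aut}(\mathbb{A}^n)$ ($n\ge 1$) is the limit $\lambda(f)=\lim_{r\to\infty}\deg(f^r)^{1/r}$, which exists. A linear projection $\pi\colon\mathbb{A}^n\to\mathbb{A}^m$ is the morphism given by a surjective $k$-linear map $k^n\to k^m$, and $f$ preserves the set of fibres of $\pi$ if the image under $f$ of each fibre of $\pi$ is a fibre of $\pi$, where fibres are taken over points with values in an algebraic closure $\bar k$ of $k$ and regarded as subsets of $\bar k^n$. Then: 1. for each $f\in\mathrm{Aut}(\mathbb{A}^2)$, the dynamical degree $\lambda(f)$ is an integer; 2. for each $f\in\mathrm{Aut}(\mathbb{A}^3)$ that preserves the set of fibres of a linear projection $\mathbb{A}^3\to\mathbb{A}^1$ or of a linear projection $\mathbb{A}^3\to\mathbb{A}^2$, the dynamical degree $\lambda(f)$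 is an integer; 3. for each $f\in\mathrm{Aut}(\mathbb{A}^4)$ that preserves the set of fibres of a linear projection $\mathbb{A}^4\to\mathbb{A}^2$, the dynamical degree $\lambda(f)$ is an integer. -/

import Mathlib

/-- A polynomial endomorphism `(f₁, …, fₙ)` of the affine space `𝔸ⁿ` over `k`, given by its
coordinate polynomials `fᵢ ∈ k[x₁, …, xₙ]`. -/
@[ext] structure AffineEnd (k : Type*) [Field k] (n : ℕ) where
  /-- The coordinate polynomials. -/
  coord : Fin n → MvPolynomial (Fin n) k

namespace AffineEnd

/-- The monoid `End(𝔸ⁿ)` under composition: `f * g = f ∘ g`, whose `i`-th coordinate is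
`fᵢ(g₁, …, gₙ)`. The group `Aut(𝔸ⁿ)` is its group of units `(AffineEnd k n)ˣ`. -/
noncomputable instance instMonoid (k : Type*) [Field k] (n : ℕ) : Monoid (AffineEnd k n) where
  mul f g := ⟨fun i => MvPolynomial.bind₁ g.coord (f.coord i)⟩
  one := ⟨fun i => MvPolynomial.X i⟩
  mul_assoc f g h := by
    ext1; funext i
    exact MvPolynomial.bind₁_bind₁ g.coord h.coord (f.coord i)
  one_mul f := by
    ext1; funext i
    exact MvPolynomial.bind₁_X_right f.coord i
  mul_one f := by
    ext1; funext i
    exact congrArg (fun φ => φ (f.coord i)) (MvPolynomial.bind₁_X_left (σ := Fin n) (R := k))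

/-- The degree `deg f = max (deg f₁, …, deg fₙ)`. -/
noncomputable def degree {k : Type*} [Field k] {n : ℕ} (f : AffineEnd k n) : ℕ :=
  Finset.univ.sup fun i => (f.coord i).totalDegree

/-- The (first) dynamical degree `λ(f) = lim_{r → ∞} deg(f ^ r) ^ (1 / r)`. -/
noncomputable def dynamicalDegree {k : Type*} [Field k] {n : ℕ} (f : AffineEnd k n) : ℝ :=
  Filter.limUnder Filter.atTop fun r : ℕ => ((f ^ r).degree : ℝ) ^ (1 / (r : ℝ))

theorem degree_mul_le {k : Type*} [Field k] {n : ℕ} (f g : AffineEnd k n) :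
    (f * g).degree ≤ f.degree * g.degree := by
  refine Finset.sup_le fun i _ => ?_
  change (MvPolynomial.bind₁ g.coord (f.coord i)).totalDegree ≤ _
  rw [MvPolynomial.bind₁, MvPolynomial.aeval_def, MvPolynomial.eval₂_eq]
  refine MvPolynomial.totalDegree_finsetSum_le fun d hd => ?_
  refine (MvPolynomial.totalDegree_mul _ _).trans ?_
  rw [MvPolynomial.algebraMap_eq, MvPolynomial.totalDegree_C, zero_add]
  refine (MvPolynomial.totalDegree_finsetProd _ _).trans ?_
  calc ∑ j ∈ d.support, (g.coord j ^ d j).totalDegree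
      ≤ ∑ j ∈ d.support, d j * g.degree := Finset.sum_le_sum fun j _ =>
        (MvPolynomial.totalDegree_pow _ _).trans (Nat.mul_le_mul_left _
          (Finset.le_sup (f := fun i => (g.coord i).totalDegree) (Finset.mem_univ j)))
    _ = (d.sum fun _ e => e) * g.degree := by rw [Finsupp.sum, Finset.sum_mul]
    _ ≤ f.degree * g.degree := Nat.mul_le_mul_right _
        ((MvPolynomial.le_totalDegree hd).trans
          (Finset.le_sup (f := fun i => (f.coord i).totalDegree) (Finset.mem_univ i)))

/-- The limit that defines the dynamical degree exists. -/
theorem tendsto_dynamicalDegree {k : Type*} [Field k] {n : ℕ} (f : AffineEnd k n) :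
    Filter.Tendsto (fun r : ℕ => ((f ^ r).degree : ℝ) ^ (1 / (r : ℝ))) Filter.atTop
      (nhds f.dynamicalDegree) := by
  refine tendsto_nhds_limUnder ?_
  have hmul : ∀ r s : ℕ, (f ^ (r + s)).degree ≤ (f ^ r).degree * (f ^ s).degree := fun r s => by
    rw [pow_add]; exact degree_mul_le _ _
  by_cases h0 : ∃ N, (f ^ N).degree = 0
  · obtain ⟨N, hN⟩ := h0
    refine ⟨0, tendsto_const_nhds.congr' ?_⟩
    filter_upwards [Filter.eventually_ge_atTop (N + 1)] with r hr
    have hz : (f ^ r).degree = 0 := by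
      have := hmul N (r - N)
      rw [hN, zero_mul, Nat.add_sub_cancel' (by omega)] at this
      omega
    have hr0 : (r : ℝ) ≠ 0 := by
      have : r ≠ 0 := by omega
      exact_mod_cast this
    rw [hz, Nat.cast_zero, Real.zero_rpow (one_div_ne_zero hr0)]
  · push Not at h0
    have hpos : ∀ r, (0 : ℝ) < ((f ^ r).degree : ℝ) := fun r => by
      exact_mod_cast Nat.pos_of_ne_zero (h0 r)
    have hsub : Subadditive fun r : ℕ => Real.log ((f ^ r).degree : ℝ) := fun r s => by
      rw [← Real.log_mul (hpos r).ne' (hpos s).ne']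
      exact Real.log_le_log (hpos _) (by exact_mod_cast hmul r s)
    have hbdd : BddBelow (Set.range fun r : ℕ => Real.log ((f ^ r).degree : ℝ) / (r : ℝ)) := by
      refine ⟨0, ?_⟩
      rintro _ ⟨r, rfl⟩
      exact div_nonneg (Real.log_natCast_nonneg _) (Nat.cast_nonneg r)
    refine ⟨Real.exp hsub.lim, ((Real.continuous_exp.tendsto _).comp
      (hsub.tendsto_lim hbdd)).congr fun r => ?_⟩
    rw [Function.comp_apply, Real.rpow_def_of_pos (hpos r), mul_one_div]

/-- The map `Kⁿ → Kⁿ` induced by an endomorphism of `𝔸ⁿ` on points with values in an extension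
`K` of `k`. -/
noncomputable def onPoints {k : Type*} [Field k] {n : ℕ} (f : AffineEnd k n)
    (K : Type*) [Field K] [Algebra k K] (x : Fin n → K) : Fin n → K :=
  fun i => MvPolynomial.aeval x (f.coord i)

end AffineEnd

/-- A linear projection `𝔸ⁿ → 𝔸ᵐ` over `k`: a surjective linear map `kⁿ → kᵐ`, given by its
matrix. -/
structure LinearProjection (k : Type*) [Field k] (n m : ℕ) where
  /-- The matrix of the projection. -/
  matrix : Matrix (Fin m) (Fin n) k
  /-- The projection is surjective. -/
  surjective : Function.Surjective matrix.mulVec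

namespace LinearProjection

/-- The map `Kⁿ → Kᵐ` induced by a linear projection on points with values in an extension `K`
of `k`. -/
def onPoints {k : Type*} [Field k] {n m : ℕ} (π : LinearProjection k n m)
    (K : Type*) [Field K] [Algebra k K] (x : Fin n → K) : Fin m → K :=
  (π.matrix.map (algebraMap k K)).mulVec x

/-- The set of (geometric) fibres of a linear projection, where the fibre over a point of `𝔸ᵐ` with
values in the algebraic closure of `k` is given by its set of points with values in this
algebraic closure. -/
def fibres {k : Type*} [Field k] {n m : ℕ} (π : LinearProjection k n m) :
    Set (Set (Fin n → AlgebraicClosure k)) :=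
  Set.range fun a : Fin m → AlgebraicClosure k => π.onPoints (AlgebraicClosure k) ⁻¹' {a}

end LinearProjection

/-- The endomorphism `f` of `𝔸ⁿ` preserves the set of fibres of the linear projection `π`: the image
under `f` of every fibre of `π` is again a fibre of `π`. -/
def AffineEnd.PreservesFibres {k : Type*} [Field k] {n m : ℕ} (f : AffineEnd k n)
    (π : LinearProjection k n m) : Prop :=
  ∀ F ∈ π.fibres, f.onPoints (AlgebraicClosure k) '' F ∈ π.fibres

/-!
Write an automorphism of the plane as a word in affine and triangular automorphisms. A reduced word
of even length multiplies its degree by the product of the degrees of its triangular letters, and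
this stays true if a field endomorphism is applied to its coefficients. Every plane automorphism is
conjugate, also in the sense twisted by a field endomorphism, to such a word or to an affine or a
triangular automorphism, whose powers have bounded degree; so its degree growth is integral.

That affine and triangular automorphisms generate the plane automorphisms is Jung's and van der
Kulk's theorem. If `φ` has degree greater than one, a coordinate `p` of `φ⁻¹` has a weighted leading
form `P` that vanishes at the leading forms of `φ`, so `P` is divisible by some `x ^ a - c y ^ b`
with `a` and `b` coprime. Conjugating a translation flow by `φ` gives a nonconstant deformation of
the identity that fixes `p`; its leading form fixes `P`, and hence the binomial. But for `a, b ≥ 2`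
the equation `u ^ a - c v ^ b = x ^ a - c y ^ b` has no nonconstant polynomial deformations, by the
Mason-Stothers theorem, or by a differentiation if the characteristic divides `a` or `b`. So one
degree divides the other, and a triangular automorphism lowers the degree of `φ`.

In linear coordinates adapted to the projection, an automorphism `f` that preserves fibres has the
form `(x, y) ↦ (g x, h x y)`. The degree of `f ^ r` is comparable to the maximum of the degree of
`g ^ r` and the degree of the generic fibre of `f ^ r`, the latter being an automorphism over the
field of rational functions on the base. So the dynamical degree of `f` is the larger of the growth
rates of the two. The generic fibre of `f ^ r` is the `r`-th iterate of the generic fibre of `f`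
twisted by the action of `g` on rational functions, and this explains why twisted iterates of plane
automorphisms are needed.
-/

section LeadingForm

open MvPolynomial

variable {σ τ M R : Type*} [CommSemiring R] [AddCommMonoid M] [LinearOrder M]

/-- The polynomial `p` has weight at most `a` for the weights `w` of the variables, and `P` is its
component of weight exactly `a`. Allowing `P = 0` makes this notion stable under products over
rings with zero divisors and under substitution. -/
structure HasLeadingForm (w : σ → M) (a : M) (p P : MvPolynomial σ R) : Prop where
  weight_le : ∀ d ∈ p.support, Finsupp.weight w d ≤ a
  component_eq : weightedHomogeneousComponent w a p = P

namespace HasLeadingForm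

variable {w : σ → M} {a b : M} {p q P Q : MvPolynomial σ R}

theorem of_isWeightedHomogeneous (hp : IsWeightedHomogeneous w p a) : HasLeadingForm w a p p :=
  ⟨fun _ hd => (hp (mem_support_iff.1 hd)).le, hp.weightedHomogeneousComponent_same⟩

theorem isWeightedHomogeneous (h : HasLeadingForm w a p P) : IsWeightedHomogeneous w P a :=
  h.component_eq ▸ weightedHomogeneousComponent_isWeightedHomogeneous a p

theorem coeff_eq (h : HasLeadingForm w a p P) {d : σ →₀ ℕ} (hd : Finsupp.weight w d = a) :
    P.coeff d = p.coeff d := by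
  classical rw [← h.component_eq, coeff_weightedHomogeneousComponent, if_pos hd]

theorem coeff_eq_zero (h : HasLeadingForm w a p P) {d : σ →₀ ℕ} (hd : a < Finsupp.weight w d) :
    p.coeff d = 0 :=
  notMem_support_iff.1 fun hmem => (h.weight_le d hmem).not_gt hd

theorem zero_of_lt (h : HasLeadingForm w a p P) (hab : a < b) : HasLeadingForm w b p 0 :=
  ⟨fun d hd => (h.weight_le d hd).trans hab.le,
    weightedHomogeneousComponent_eq_zero' _ _ fun d hd => ((h.weight_le d hd).trans_lt hab).ne⟩

theorem add (hp : HasLeadingForm w a p P) (hq : HasLeadingForm w a q Q) :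
    HasLeadingForm w a (p + q) (P + Q) := by
  classical
  refine ⟨fun d hd => ?_, by rw [map_add, hp.component_eq, hq.component_eq]⟩
  exact (Finset.mem_union.1 (support_add hd)).elim (hp.weight_le d) (hq.weight_le d)

theorem sum {ι : Type*} (s : Finset ι) {p P : ι → MvPolynomial σ R}
    (h : ∀ i ∈ s, HasLeadingForm w a (p i) (P i)) :
    HasLeadingForm w a (∑ i ∈ s, p i) (∑ i ∈ s, P i) := by
  classical
  induction s using Finset.induction_on with
  | empty =>
    simpa only [Finset.sum_empty] using
      of_isWeightedHomogeneous (isWeightedHomogeneous_zero R w a)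
  | insert i s hi ih =>
    rw [Finset.sum_insert hi, Finset.sum_insert hi]
    exact (h i (Finset.mem_insert_self i s)).add (ih fun j hj => h j (Finset.mem_insert_of_mem hj))

theorem C_mul (h : HasLeadingForm w a p P) (r : R) : HasLeadingForm w a (C r * p) (C r * P) := by
  refine ⟨fun d hd => h.weight_le d (mem_support_iff.2 ?_), ?_⟩
  · rw [mem_support_iff, coeff_C_mul] at hd
    exact right_ne_zero_of_mul hd
  · rw [weightedHomogeneousComponent_C_mul, h.component_eq]

theorem one (w : σ → M) : HasLeadingForm w 0 (1 : MvPolynomial σ R) 1 :=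
  .of_isWeightedHomogeneous (isWeightedHomogeneous_one R w)

variable [IsOrderedCancelAddMonoid M]

theorem mul (hp : HasLeadingForm w a p P) (hq : HasLeadingForm w b q Q) :
    HasLeadingForm w (a + b) (p * q) (P * Q) := by
  classical
  have hPQ := hp.isWeightedHomogeneous.mul hq.isWeightedHomogeneous
  refine ⟨fun d hd => ?_, ?_⟩
  · obtain ⟨x, hx, y, hy, rfl⟩ := Finset.mem_add.1 (support_mul p q hd)
    rw [map_add]
    exact add_le_add (hp.weight_le x hx) (hq.weight_le y hy)
  · ext d
    rw [coeff_weightedHomogeneousComponent]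
    split_ifs with hd
    · rw [coeff_mul, coeff_mul]
      refine Finset.sum_congr rfl fun x hx => ?_
      have hsum : Finsupp.weight w x.1 + Finsupp.weight w x.2 = a + b := by
        rw [← map_add, Finset.HasAntidiagonal.mem_antidiagonal.1 hx, hd]
      obtain hx₁ | hx₁ := lt_or_ge a (Finsupp.weight w x.1)
      · rw [hp.coeff_eq_zero hx₁, hp.isWeightedHomogeneous.coeff_eq_zero _ hx₁.ne', zero_mul,
          zero_mul]
      obtain hx₂ | hx₂ := lt_or_ge b (Finsupp.weight w x.2)
      · rw [hq.coeff_eq_zero hx₂, hq.isWeightedHomogeneous.coeff_eq_zero _ hx₂.ne', mul_zero,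
          mul_zero]
      obtain ⟨h₁, h₂⟩ := (add_eq_add_iff_eq_and_eq hx₁ hx₂).1 hsum
      rw [hp.coeff_eq h₁, hq.coeff_eq h₂]
    · exact (hPQ.coeff_eq_zero d hd).symm

theorem pow (h : HasLeadingForm w a p P) (n : ℕ) : HasLeadingForm w (n • a) (p ^ n) (P ^ n) := by
  induction n with
  | zero => simpa only [pow_zero, zero_nsmul] using one w
  | succ n ih => simpa only [pow_succ, succ_nsmul] using ih.mul h

theorem prod {ι : Type*} (s : Finset ι) {p P : ι → MvPolynomial σ R} {a : ι → M}
    (h : ∀ i ∈ s, HasLeadingForm w (a i) (p i) (P i)) :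
    HasLeadingForm w (∑ i ∈ s, a i) (∏ i ∈ s, p i) (∏ i ∈ s, P i) := by
  classical
  induction s using Finset.induction_on with
  | empty => simpa only [Finset.sum_empty, Finset.prod_empty] using one w
  | insert i s hi ih =>
    rw [Finset.sum_insert hi, Finset.prod_insert hi, Finset.prod_insert hi]
    exact (h i (Finset.mem_insert_self i s)).mul (ih fun j hj => h j (Finset.mem_insert_of_mem hj))

theorem bind₁ {v : τ → M} {f F : σ → MvPolynomial τ R}
    (hf : ∀ i, HasLeadingForm v (w i) (f i) (F i))
    (hp : HasLeadingForm w a p P) :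
    HasLeadingForm v a (MvPolynomial.bind₁ f p) (MvPolynomial.bind₁ F P) := by
  classical
  have bind₁_eq_sum (g : σ → MvPolynomial τ R) (q : MvPolynomial σ R) (hq : q.support ⊆ p.support) :
      MvPolynomial.bind₁ g q =
        ∑ d ∈ p.support, C (q.coeff d) * ∏ i ∈ d.support, g i ^ d i := by
    rw [MvPolynomial.bind₁, aeval_def, eval₂_eq, algebraMap_eq]
    refine Finset.sum_subset hq fun d _ hd => ?_
    rw [notMem_support_iff.1 hd, C_0, zero_mul]
  have hPp : P.support ⊆ p.support := by
    rw [← hp.component_eq, support_weightedHomogeneousComponent]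
    exact Finset.filter_subset _ _
  rw [bind₁_eq_sum f p subset_rfl, bind₁_eq_sum F P hPp]
  refine sum _ fun d hd => ?_
  have hmonomial : HasLeadingForm v (Finsupp.weight w d) (∏ i ∈ d.support, f i ^ d i)
      (∏ i ∈ d.support, F i ^ d i) := by
    rw [Finsupp.weight_apply, Finsupp.sum]
    exact prod _ fun i _ => (hf i).pow (d i)
  obtain hlt | heq := (hp.weight_le d hd).lt_or_eq
  · rw [hp.isWeightedHomogeneous.coeff_eq_zero d hlt.ne, C_0, zero_mul]
    exact mul_zero (C (p.coeff d)) ▸ (hmonomial.zero_of_lt hlt).C_mul _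
  · rw [hp.coeff_eq heq, ← heq]
    exact hmonomial.C_mul _

theorem rename {v : τ → M} {g : σ → τ} (h : HasLeadingForm (v ∘ g) a p P) :
    HasLeadingForm v a (MvPolynomial.rename g p) (MvPolynomial.rename g P) := by
  have rename_eq_bind₁ (q : MvPolynomial σ R) :
      MvPolynomial.rename g q = MvPolynomial.bind₁ (fun i => X (g i)) q := by
    simpa only [bind₁_X_left, AlgHom.id_apply, rename_X] using rename_bind₁ X g q
  rw [rename_eq_bind₁, rename_eq_bind₁]
  exact bind₁ (fun i => of_isWeightedHomogeneous (isWeightedHomogeneous_X R v (g i))) h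

theorem natCast {𝕜 : Type*} [Semiring 𝕜] [LinearOrder 𝕜] [IsStrictOrderedRing 𝕜] {w : σ → ℕ}
    {a : ℕ} (h : HasLeadingForm w a p P) : HasLeadingForm (fun i => (w i : 𝕜)) (a : 𝕜) p P := by
  classical
  have hweight (d : σ →₀ ℕ) : Finsupp.weight (fun i => (w i : 𝕜)) d = (Finsupp.weight w d : ℕ) := by
    simp only [Finsupp.weight_apply, Finsupp.sum, Nat.cast_sum, nsmul_eq_mul, smul_eq_mul,
      Nat.cast_mul]
  refine ⟨fun d hd => hweight d ▸ Nat.cast_le.2 (h.weight_le d hd), ?_⟩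
  ext d
  simp only [← h.component_eq, coeff_weightedHomogeneousComponent, hweight, Nat.cast_inj]

end HasLeadingForm

end LeadingForm

section BinomialEquation

open Polynomial in
theorem natDegree_eq_zero_of_C_mul_pow_add_eq_C {L : Type*} [Field L] {a b : ℕ}
    (hab : a + b < a * b) (ha : (a : L) ≠ 0) (hb : (b : L) ≠ 0) {u v p : L} (hu : u ≠ 0)
    (hv : v ≠ 0) (hp : p ≠ 0) {F G : L[X]} (h : C u * F ^ a + C v * G ^ b = C p) :
    F.natDegree = 0 ∧ G.natDegree = 0 := by
  have ha₀ : a ≠ 0 := fun h => ha (by rw [h, Nat.cast_zero])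
  have hb₀ : b ≠ 0 := fun h => hb (by rw [h, Nat.cast_zero])
  have of_eq {n : ℕ} (hn : n ≠ 0) {c : L} (hc : c ≠ 0) {P : L[X]} (hP : C c * P ^ n = C p) :
      P.natDegree = 0 := by
    have := congrArg natDegree hP
    rw [natDegree_C_mul hc, natDegree_pow, natDegree_C] at this
    exact (mul_eq_zero.1 this).resolve_left hn
  obtain rfl | hF := eq_or_ne F 0
  · exact ⟨natDegree_zero, of_eq hb₀ hv (by rwa [zero_pow ha₀, mul_zero, zero_add] at h)⟩
  obtain rfl | hG := eq_or_ne G 0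
  · exact ⟨of_eq ha₀ hu (by rwa [zero_pow hb₀, mul_zero, add_zero] at h), natDegree_zero⟩
  have hcoprime : IsCoprime F G := by
    refine (IsCoprime.pow_iff (Nat.pos_of_ne_zero ha₀) (Nat.pos_of_ne_zero hb₀)).1
      ⟨C p⁻¹ * C u, C p⁻¹ * C v, ?_⟩
    rw [mul_assoc, mul_assoc, ← mul_add, h, ← C_mul, inv_mul_cancel₀ hp, C_1]
  have hineq : b * (a * b) + a * b * a + a * b ≤ a * b * (a * b) := by nlinarith
  have heq : C u * F ^ a + C v * G ^ b + C (-p) * 1 ^ (a * b) = 0 := by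
    rw [h, one_pow, mul_one, C_neg, add_neg_cancel]
  have := flt_catalan ha₀ hb₀ (mul_ne_zero ha₀ hb₀) hineq ha hb
    (by rw [Nat.cast_mul]; exact mul_ne_zero ha hb) hF hG one_ne_zero hcoprime hu hv
    (neg_ne_zero.2 hp) heq
  exact ⟨this.1, this.2.1⟩

open MvPolynomial

theorem degreeOf_none_rename_some {σ R : Type*} [CommSemiring R] (p : MvPolynomial σ R) :
    degreeOf none (rename some p) = 0 := by
  classical
  rw [degreeOf_def, Multiset.count_eq_zero, ← Multiset.mem_toFinset, ← vars_def]
  intro h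
  obtain ⟨i, -, hi⟩ := mem_vars_rename some p h
  exact Option.some_ne_none i hi

theorem optionEquivLeft_rename_some {σ R : Type*} [CommSemiring R] (p : MvPolynomial σ R) :
    optionEquivLeft R σ (rename some p) = Polynomial.C p :=
  RingHom.congr_fun (f := (optionEquivLeft R σ).toRingHom.comp (rename some).toRingHom)
    (g := Polynomial.C) (ringHom_ext (fun x => by simp) fun i => by simp) p

variable {σ K : Type*} [Field K] {a b : ℕ} {u v : K} {F G : MvPolynomial (Option σ) K}

theorem degreeOf_none_eq_zero_of_natCast_ne_zero (hab : a + b < a * b) (ha : (a : K) ≠ 0)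
    (hb : (b : K) ≠ 0) (hu : u ≠ 0) (hv : v ≠ 0) {p : MvPolynomial σ K} (hp : p ≠ 0)
    (h : C u * F ^ a + C v * G ^ b = rename some p) :
    degreeOf none F = 0 ∧ degreeOf none G = 0 := by
  let ψ : MvPolynomial σ K →+* FractionRing (MvPolynomial σ K) := algebraMap _ _
  have hψ : Function.Injective ψ := IsFractionRing.injective _ _
  let φ : MvPolynomial (Option σ) K →+* Polynomial (FractionRing (MvPolynomial σ K)) :=
    (Polynomial.mapRingHom ψ).comp (optionEquivLeft K σ).toRingHom
  have hφ (q : MvPolynomial σ K) : φ (rename some q) = Polynomial.C (ψ q) := by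
    simp [φ, optionEquivLeft_rename_some]
  have hdegree (q : MvPolynomial (Option σ) K) : (φ q).natDegree = degreeOf none q := by
    rw [← natDegree_optionEquivLeft]
    exact Polynomial.natDegree_map_eq_of_injective hψ _
  have hcast {n : ℕ} (hn : (n : K) ≠ 0) : (n : FractionRing (MvPolynomial σ K)) ≠ 0 := by
    rw [← map_natCast (ψ.comp C)]
    exact (map_ne_zero _).2 hn
  have hC {x : K} (hx : x ≠ 0) : ψ (C x) ≠ 0 := (map_ne_zero_iff ψ hψ).2 (C_ne_zero.2 hx)
  rw [← hdegree, ← hdegree]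
  refine natDegree_eq_zero_of_C_mul_pow_add_eq_C hab (hcast ha) (hcast hb) (hC hu) (hC hv)
    ((map_ne_zero_iff ψ hψ).2 hp) ?_
  rw [← hφ, ← hφ, ← hφ, ← h, rename_C, rename_C, map_add, map_mul, map_mul, map_pow, map_pow]

-- A derivation in the variables other than `none` kills `G ^ b`, so that `F ^ (a - 1)` divides a
-- polynomial free of `none`.
theorem degreeOf_none_eq_zero_of_natCast_eq_zero (ha : 2 ≤ a) (hb₀ : b ≠ 0) (hb : (b : K) = 0)
    (hv : v ≠ 0) {p : MvPolynomial σ K} {i : σ} (hp : pderiv i p ≠ 0)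
    (h : C u * F ^ a + C v * G ^ b = rename some p) :
    degreeOf none F = 0 ∧ degreeOf none G = 0 := by
  have hF : degreeOf none F = 0 := by
    have hderiv : F ^ (a - 1) * (C u * C (a : K) * pderiv (some i) F) =
        rename some (pderiv i p) := by
      rw [← pderiv_rename (Option.some_injective σ), ← h, map_add, pderiv_C_mul, pderiv_C_mul,
        pderiv_pow, pderiv_pow, ← C_eq_coe_nat b, hb, ← C_eq_coe_nat a, C_0]
      ring
    have hne := hderiv ▸ (map_ne_zero_iff _ (rename_injective _ (Option.some_injective σ))).2 hp
    have hF₀ : F ≠ 0 := by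
      rintro rfl
      exact hne (by rw [zero_pow (by omega), zero_mul])
    have hdeg := congrArg (degreeOf none) hderiv
    rw [degreeOf_none_rename_some, degreeOf_mul_eq (left_ne_zero_of_mul hne)
      (right_ne_zero_of_mul hne), degreeOf_pow_eq _ _ _ hF₀] at hdeg
    exact (mul_eq_zero.1 (Nat.add_eq_zero_iff.1 hdeg).1).resolve_left (by omega)
  refine ⟨hF, ?_⟩
  obtain rfl | hG := eq_or_ne G 0
  · exact degreeOf_zero none
  have hdeg := (degreeOf_sub_le none (rename some p) (C u * F ^ a)).trans
    (max_le_max_left _ ((degreeOf_C_mul_le _ _ _).trans (degreeOf_pow_le none F a)))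
  rw [← h, add_sub_cancel_left, h, degreeOf_C_mul _ _ (mem_nonZeroDivisors_of_ne_zero hv),
    degreeOf_pow_eq _ _ _ hG, degreeOf_none_rename_some, hF, mul_zero, max_self] at hdeg
  exact (mul_eq_zero.1 (Nat.le_zero.1 hdeg)).resolve_left hb₀

theorem degreeOf_none_eq_zero_of_C_mul_pow_add_eq {i j : σ} (hij : i ≠ j) (ha : 2 ≤ a)
    (hb : 2 ≤ b) (hab : a.Coprime b) (hu : u ≠ 0) (hv : v ≠ 0)
    (h : C u * F ^ a + C v * G ^ b = rename some (C u * X i ^ a + C v * X j ^ b)) :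
    degreeOf none F = 0 ∧ degreeOf none G = 0 := by
  have pderiv_ne_zero {n m : ℕ} {x y : K} {k l : σ} (hkl : k ≠ l) (hx : x ≠ 0) (hn : (n : K) ≠ 0) :
      pderiv k (C x * X k ^ n + C y * X l ^ m) ≠ 0 := by
    rw [map_add, pderiv_C_mul, pderiv_C_mul, pderiv_pow, pderiv_pow, pderiv_X_self,
      pderiv_X_of_ne hkl.symm, mul_zero, mul_zero, add_zero, mul_one, ← C_eq_coe_nat]
    exact mul_ne_zero (C_ne_zero.2 hx) (mul_ne_zero (C_ne_zero.2 hn) (pow_ne_zero _ (X_ne_zero k)))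
  by_cases ha' : (a : K) = 0
  · have hb' : (b : K) ≠ 0 := fun hb' => by
      have := (Nat.isCoprime_iff_coprime.2 hab).map (Int.castRingHom K)
      rw [map_natCast, map_natCast, ha', hb'] at this
      exact not_isCoprime_zero_zero this
    rw [add_comm, add_comm (C u * X i ^ a)] at h
    exact (degreeOf_none_eq_zero_of_natCast_eq_zero hb (by omega) ha' hu
      (pderiv_ne_zero hij.symm hv hb') h).symm
  by_cases hb' : (b : K) = 0
  · exact degreeOf_none_eq_zero_of_natCast_eq_zero ha (by omega) hb' hv
      (pderiv_ne_zero hij hu ha') h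
  have hlt : a + b < a * b := by
    have hne : a ≠ b := by
      rintro rfl
      exact absurd hab (by rw [Nat.coprime_self]; omega)
    obtain hab | hab := hne.lt_or_gt <;> nlinarith
  refine degreeOf_none_eq_zero_of_natCast_ne_zero hlt ha' hb' hu hv (fun h0 => ?_) h
  exact pderiv_ne_zero (y := v) (m := b) hij hu ha' (by rw [h0, map_zero])

end BinomialEquation

section Deformation

open MvPolynomial

section SpecializeZero

variable {σ R : Type*} [CommSemiring R]

/-- The substitution of `0` for the variable `none`, which plays the role of the parameter of a
family of polynomials. -/
noncomputable def specializeZero : MvPolynomial (Option σ) R →ₐ[R] MvPolynomial σ R :=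
  bind₁ fun o => o.elim 0 X

theorem specializeZero_X_none : specializeZero (X none : MvPolynomial (Option σ) R) = 0 :=
  bind₁_X_right _ _

theorem specializeZero_rename_some (p : MvPolynomial σ R) :
    specializeZero (rename some p) = p := by
  rw [specializeZero, bind₁, aeval_rename]
  exact aeval_X_left_apply p

theorem coeff_zero_optionEquivLeft (p : MvPolynomial (Option σ) R) :
    (optionEquivLeft R σ p).coeff 0 = specializeZero p := by
  refine RingHom.congr_fun
    (f := Polynomial.constantCoeff.comp (optionEquivLeft R σ : _ →+* Polynomial (MvPolynomial σ R)))
    (g := specializeZero.toRingHom)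
    (ringHom_ext (fun r => ?_) fun o => ?_) p
  · simp [specializeZero]
  · cases o <;> simp [specializeZero]

theorem coeff_specializeZero (p : MvPolynomial (Option σ) R) (d : σ →₀ ℕ) :
    (specializeZero p).coeff d = p.coeff (d.optionElim 0) := by
  rw [← coeff_zero_optionEquivLeft, optionEquivLeft_coeff_coeff]

theorem rename_some_specializeZero {p : MvPolynomial (Option σ) R} (hp : degreeOf none p = 0) :
    rename some (specializeZero p) = p := by
  apply (optionEquivLeft R σ).injective
  rw [← natDegree_optionEquivLeft] at hp
  rw [optionEquivLeft_rename_some, ← coeff_zero_optionEquivLeft,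
    ← Polynomial.eq_C_of_natDegree_eq_zero hp]

theorem HasLeadingForm.specializeZero {M : Type*} [AddCommMonoid M] [LinearOrder M]
    [IsOrderedCancelAddMonoid M] {w : Option σ → M} {a : M} {p P : MvPolynomial (Option σ) R}
    (h : HasLeadingForm w a p P) :
    HasLeadingForm (w ∘ some) a (specializeZero p) (specializeZero P) := by
  refine h.bind₁ fun o => of_isWeightedHomogeneous ?_
  cases o with
  | none => exact isWeightedHomogeneous_zero R _ _
  | some i => exact isWeightedHomogeneous_X R (w ∘ some) i

end SpecializeZero

theorem weight_option {σ M : Type*} [AddCommMonoid M] (τ : M) (ω : σ → M) (d : Option σ →₀ ℕ) :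
    Finsupp.weight (fun o => o.elim τ ω) d = d none • τ + Finsupp.weight ω d.some := by
  rw [Finsupp.weight_apply, Finsupp.weight_apply, Finsupp.sum_option_index_smul]
  rfl

variable {σ K : Type*} [Field K] {H : σ → MvPolynomial (Option σ) K}

theorem bind₁_eq_rename_some_of_dvd (hH : ∀ i, specializeZero (H i) = X i) {p q : MvPolynomial σ K}
    (hp : p ≠ 0) (hHp : bind₁ H p = rename some p) (hqp : q ∣ p) :
    bind₁ H q = rename some q := by
  obtain ⟨r, rfl⟩ := hqp
  have hne : bind₁ H q * bind₁ H r ≠ 0 := by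
    rw [← map_mul, hHp]
    exact (map_ne_zero_iff _ (rename_injective _ (Option.some_injective σ))).2 hp
  have hdegree := degreeOf_none_rename_some (q * r)
  rw [← hHp, map_mul, degreeOf_mul_eq (left_ne_zero_of_mul hne) (right_ne_zero_of_mul hne)]
    at hdegree
  rw [← rename_some_specializeZero (Nat.add_eq_zero_iff.1 hdegree).1, specializeZero,
    bind₁_bind₁, ← specializeZero]
  simp only [hH]
  rw [bind₁_X_left, AlgHom.id_apply]

variable [Finite σ] {𝕜 : Type*} [Field 𝕜] [LinearOrder 𝕜] [IsStrictOrderedRing 𝕜] {ω : σ → 𝕜}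

-- The weight of the parameter is the largest one for which no monomial of `H i` exceeds `ω i`.
theorem exists_weight_of_deformation (ω : σ → 𝕜) (hH : ∀ i, specializeZero (H i) = X i)
    (hne : ∃ i, degreeOf none (H i) ≠ 0) :
    ∃ (τ : 𝕜) (P : σ → MvPolynomial (Option σ) K),
      (∀ i, HasLeadingForm (fun o => o.elim τ ω) (ω i) (H i) (P i)) ∧
        ∃ i, degreeOf none (P i) ≠ 0 := by
  classical
  cases nonempty_fintype σ
  let S : Finset (Σ _ : σ, Option σ →₀ ℕ) :=
    Finset.univ.sigma fun i => (H i).support.filter fun d => d none ≠ 0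
  have mem_S {i d} : ⟨i, d⟩ ∈ S ↔ d ∈ (H i).support ∧ d none ≠ 0 := by
    simp only [S, Finset.mem_sigma, Finset.mem_univ, true_and, Finset.mem_filter]
  have hS : S.Nonempty := by
    obtain ⟨i, hi⟩ := hne
    by_contra! hempty
    refine hi (Nat.le_zero.1 (degreeOf_le_iff.2 fun d hd => Nat.le_zero.2 ?_))
    by_contra hd₀
    exact Finset.notMem_empty _ (hempty ▸ mem_S.2 ⟨hd, hd₀⟩)
  let slope (x : Σ _ : σ, Option σ →₀ ℕ) : 𝕜 :=
    (ω x.1 - Finsupp.weight ω x.2.some) / x.2 none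
  obtain ⟨⟨i₀, d₀⟩, hmem₀, hmin⟩ := S.exists_min_image slope hS
  obtain ⟨hd₀, hd₀none⟩ := mem_S.1 hmem₀
  let w : Option σ → 𝕜 := fun o => o.elim (slope ⟨i₀, d₀⟩) ω
  refine ⟨slope ⟨i₀, d₀⟩, fun i => weightedHomogeneousComponent w (ω i) (H i),
    fun i => ⟨fun d hd => ?_, rfl⟩, i₀, fun hzero => ?_⟩
  · rw [weight_option, nsmul_eq_mul]
    obtain hdnone | hdnone := eq_or_ne (d none) 0
    · have hcoeff := mem_support_iff.1 hd
      rw [← Finsupp.optionElim_some d, hdnone, ← coeff_specializeZero, hH, coeff_X,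
        ne_eq, ite_eq_right_iff, Classical.not_imp] at hcoeff
      rw [hdnone, Nat.cast_zero, zero_mul, zero_add, ← hcoeff.1, Finsupp.weight_single, one_smul]
    · have hle := hmin ⟨i, d⟩ (mem_S.2 ⟨hd, hdnone⟩)
      rwa [le_div_iff₀ (Nat.cast_pos.2 (Nat.pos_of_ne_zero hdnone)), le_sub_iff_add_le,
        mul_comm] at hle
  · have hweight : Finsupp.weight w d₀ = ω i₀ := by
      rw [weight_option, nsmul_eq_mul, mul_div_cancel₀ _ (Nat.cast_ne_zero.2 hd₀none),
        sub_add_cancel]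
    refine hd₀none (Nat.le_zero.1 (hzero ▸ monomial_le_degreeOf none (mem_support_iff.2 ?_)))
    rw [coeff_weightedHomogeneousComponent, if_pos hweight]
    exact mem_support_iff.1 hd₀

theorem exists_leadingForm_of_deformation (hH : ∀ i, specializeZero (H i) = X i)
    (hne : ∃ i, degreeOf none (H i) ≠ 0) {p P : MvPolynomial σ K} {a : 𝕜}
    (hp : HasLeadingForm ω a p P) (hHp : bind₁ H p = rename some p) :
    ∃ Q : σ → MvPolynomial (Option σ) K, (∀ i, specializeZero (Q i) = X i) ∧
      (∃ i, degreeOf none (Q i) ≠ 0) ∧ bind₁ Q P = rename some P := by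
  obtain ⟨τ, Q, hQ, hQne⟩ := exists_weight_of_deformation ω hH hne
  refine ⟨Q, fun i => ?_, hQne, ?_⟩
  · rw [← (hQ i).specializeZero.component_eq, hH]
    exact (isWeightedHomogeneous_X K ω i).weightedHomogeneousComponent_same
  · have hbind := HasLeadingForm.bind₁ hQ hp
    rw [hHp] at hbind
    have hrename : HasLeadingForm (fun o => o.elim τ ω) a (rename some p) (rename some P) :=
      HasLeadingForm.rename hp
    rw [← hbind.component_eq, hrename.component_eq]

theorem not_two_le_of_deformation {ω : Fin 2 → 𝕜} {H : Fin 2 → MvPolynomial (Option (Fin 2)) K}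
    (hH : ∀ i, specializeZero (H i) = X i) (hne : ∃ i, degreeOf none (H i) ≠ 0)
    {p P : MvPolynomial (Fin 2) K} {N : 𝕜} (hp : HasLeadingForm ω N p P) (hP : P ≠ 0)
    (hHp : bind₁ H p = rename some p) {a b : ℕ} (hab : a.Coprime b) {c : K} (hc : c ≠ 0)
    (hdvd : X 0 ^ a - C c * X 1 ^ b ∣ P) : ¬(2 ≤ a ∧ 2 ≤ b) := by
  rintro ⟨ha, hb⟩
  obtain ⟨Q, hQ, ⟨i, hi⟩, hQP⟩ := exists_leadingForm_of_deformation hH hne hp hHp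
  have hbinomial : (X 0 ^ a - C c * X 1 ^ b : MvPolynomial (Fin 2) K) =
      C 1 * X 0 ^ a + C (-c) * X 1 ^ b := by
    rw [C_1, C_neg]
    ring
  have heq := bind₁_eq_rename_some_of_dvd hQ hP hQP (hbinomial ▸ hdvd)
  have hconst : degreeOf none (Q 0) = 0 ∧ degreeOf none (Q 1) = 0 := by
    refine degreeOf_none_eq_zero_of_C_mul_pow_add_eq zero_ne_one ha hb hab one_ne_zero
      (neg_ne_zero.2 hc) ?_
    rw [← heq]
    simp only [map_add, map_mul, map_pow, bind₁_C_right, bind₁_X_right]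
  exact hi (by fin_cases i; exacts [hconst.1, hconst.2])

end Deformation

namespace AffineEnd

open MvPolynomial

variable {K : Type*} [Field K] {n : ℕ}

theorem coord_mul (f g : AffineEnd K n) (i : Fin n) :
    (f * g).coord i = bind₁ g.coord (f.coord i) := rfl

theorem coord_one (i : Fin n) : (1 : AffineEnd K n).coord i = X i := rfl

theorem bind₁_inv_coord (φ : (AffineEnd K n)ˣ) (i : Fin n) :
    bind₁ (φ⁻¹).1.coord (φ.1.coord i) = X i := by
  rw [← coord_mul, Units.mul_inv, coord_one]

theorem bind₁_coord_inv (φ : (AffineEnd K n)ˣ) (i : Fin n) :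
    bind₁ φ.1.coord ((φ⁻¹).1.coord i) = X i := by
  rw [← coord_mul, Units.inv_mul, coord_one]

theorem totalDegree_coord_le (f : AffineEnd K n) (i : Fin n) :
    (f.coord i).totalDegree ≤ f.degree :=
  Finset.le_sup (f := fun i => (f.coord i).totalDegree) (Finset.mem_univ i)

theorem totalDegree_coord_pos (φ : (AffineEnd K n)ˣ) (i : Fin n) :
    0 < (φ.1.coord i).totalDegree := by
  by_contra! h
  have hX := bind₁_inv_coord φ i
  rw [totalDegree_eq_zero_iff_eq_C.1 (Nat.le_zero.1 h), bind₁_C_right] at hX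
  have hdegree := congrArg totalDegree hX
  rw [totalDegree_C, totalDegree_X] at hdegree
  exact zero_ne_one hdegree

/-- The flow of the translations in the `j`-th coordinate, conjugated by `φ`. The variable `none`
is the time of the flow. -/
noncomputable def translationFlow (φ : (AffineEnd K n)ˣ) (j i : Fin n) :
    MvPolynomial (Option (Fin n)) K :=
  bind₁ (fun l => rename some ((φ⁻¹).1.coord l) + if l = j then X none else 0) (φ.1.coord i)

theorem specializeZero_translationFlow (φ : (AffineEnd K n)ˣ) (j i : Fin n) :
    specializeZero (translationFlow φ j i) = X i := by
  rw [translationFlow, specializeZero, bind₁_bind₁, ← specializeZero, ← bind₁_inv_coord φ i]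
  congr 2
  ext1 l
  rw [map_add, specializeZero_rename_some, apply_ite specializeZero, specializeZero_X_none,
    map_zero, ite_self, add_zero]

theorem bind₁_translationFlow (φ : (AffineEnd K n)ˣ) (j l : Fin n) :
    bind₁ (translationFlow φ j) ((φ⁻¹).1.coord l) =
      rename some ((φ⁻¹).1.coord l) + if l = j then X none else 0 := by
  have hflow : translationFlow φ j = fun i => bind₁ (fun l => rename some ((φ⁻¹).1.coord l) +
      if l = j then X none else 0) (φ.1.coord i) := rfl
  rw [hflow, ← bind₁_bind₁, bind₁_coord_inv, bind₁_X_right]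

theorem exists_degreeOf_translationFlow_ne_zero (φ : (AffineEnd K n)ˣ) (j : Fin n) :
    ∃ i, degreeOf none (translationFlow φ j i) ≠ 0 := by
  by_contra! h
  have hflow : translationFlow φ j = fun i => rename some (X i) := by
    ext1 i
    rw [← rename_some_specializeZero (h i), specializeZero_translationFlow]
  have hbind := bind₁_translationFlow φ j j
  rw [hflow, ← rename_bind₁, bind₁_X_left, AlgHom.id_apply, if_pos rfl, left_eq_add] at hbind
  exact X_ne_zero _ hbind

end AffineEnd

section BinomialDivisor

open MvPolynomial

variable {σ K : Type*} [Field K]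

theorem exists_eq_C_mul_of_isAlgebraic_div {F G : MvPolynomial σ K} {n : ℕ}
    (hF : F.IsHomogeneous n) (hG : G.IsHomogeneous n) (hF₀ : F ≠ 0) (hG₀ : G ≠ 0)
    (halg : IsAlgebraic K (algebraMap _ (FractionRing (MvPolynomial σ K)) F /
      algebraMap _ (FractionRing (MvPolynomial σ K)) G)) :
    ∃ c : K, c ≠ 0 ∧ F = C c * G := by
  have hint := halg.isIntegral.tower_top (A := MvPolynomial σ K)
  obtain ⟨s, hs⟩ := IsIntegrallyClosed.algebraMap_eq_of_integral hint
  have hinj := IsFractionRing.injective (MvPolynomial σ K) (FractionRing (MvPolynomial σ K))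
  rw [eq_div_iff ((map_ne_zero_iff _ hinj).2 hG₀), ← map_mul] at hs
  obtain rfl : s * G = F := hinj hs
  have hs₀ := left_ne_zero_of_mul hF₀
  have hdegree := totalDegree_mul_of_isDomain hs₀ hG₀
  rw [hF.totalDegree hF₀, hG.totalDegree hG₀, right_eq_add] at hdegree
  obtain ⟨c, rfl⟩ : ∃ c, s = C c := ⟨_, totalDegree_eq_zero_iff_eq_C.1 hdegree⟩
  exact ⟨c, C_ne_zero.1 hs₀, rfl⟩

section BinaryForms

variable {A : Type*} [CommRing A] [Algebra K A] {Q : MvPolynomial (Fin 2) K} {N : ℕ}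

theorem algHom_aeval_pair {B : Type*} [CommRing B] [Algebra K B] (φ : A →ₐ[K] B) (x y : A)
    (Q : MvPolynomial (Fin 2) K) : φ (aeval ![x, y] Q) = aeval ![φ x, φ y] Q := by
  rw [← AlgHom.comp_apply, comp_aeval]
  congr 2
  ext1 i
  fin_cases i <;> rfl

theorem aeval_pair_mul_left (hQ : Q.IsHomogeneous N) (t x y : A) :
    aeval ![t * x, t * y] Q = t ^ N * aeval ![x, y] Q := by
  rw [aeval_def, aeval_def, eval₂_eq', eval₂_eq', Finset.mul_sum]
  refine Finset.sum_congr rfl fun d hd => ?_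
  rw [← hQ (mem_support_iff.1 hd)]
  simp only [Fin.prod_univ_two, Matrix.cons_val_zero, Matrix.cons_val_one, mul_pow,
    Finsupp.weight_apply, Pi.one_apply, smul_eq_mul, mul_one, implies_true, Finsupp.sum_fintype,
    Fin.sum_univ_two, pow_add]
  ring

theorem X_sub_C_mul_X_dvd_of_aeval_eq_zero (hQ : Q.IsHomogeneous N) {c : K}
    (hc : aeval ![c, 1] Q = 0) : X 0 - C c * X 1 ∣ Q := by
  let I : Ideal (MvPolynomial (Fin 2) K) := Ideal.span {X 0 - C c * X 1}
  have hX : Ideal.Quotient.mkₐ K I (X 0) = Ideal.Quotient.mkₐ K I (X 1 * C c) :=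
    Ideal.Quotient.eq.2 (by rw [mul_comm (X 1)]; exact Ideal.mem_span_singleton_self _)
  have hvars : ![X 0, X 1] = (X : Fin 2 → MvPolynomial (Fin 2) K) :=
    funext (Fin.forall_fin_two.2 ⟨rfl, rfl⟩)
  rw [← Ideal.mem_span_singleton, ← Ideal.Quotient.eq_zero_iff_mem]
  calc Ideal.Quotient.mkₐ K I Q
      = Ideal.Quotient.mkₐ K I (aeval ![X 0, X 1] Q) := by rw [hvars, aeval_X_left_apply]
    _ = Ideal.Quotient.mkₐ K I (aeval ![X 1 * C c, X 1 * C 1] Q) := by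
      rw [algHom_aeval_pair, hX, ← algHom_aeval_pair, C_1, mul_one]
    _ = Ideal.Quotient.mkₐ K I (X 1 ^ N * Algebra.ofId K _ (aeval ![c, 1] Q)) := by
      rw [aeval_pair_mul_left hQ, algHom_aeval_pair]
      rfl
    _ = 0 := by rw [hc, map_zero, mul_zero, map_zero]

theorem exists_X_sub_C_mul_X_dvd (hQ : Q.IsHomogeneous N) (hQ₀ : Q ≠ 0) {F G : MvPolynomial σ K}
    {n : ℕ} (hF : F.IsHomogeneous n) (hG : G.IsHomogeneous n) (hF₀ : F ≠ 0) (hG₀ : G ≠ 0)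
    (hQFG : aeval ![F, G] Q = 0) : ∃ c : K, c ≠ 0 ∧ F = C c * G ∧ X 0 - C c * X 1 ∣ Q := by
  let ι : MvPolynomial σ K →ₐ[K] FractionRing (MvPolynomial σ K) := IsScalarTower.toAlgHom _ _ _
  have hinj : Function.Injective ι := IsFractionRing.injective _ _
  have hιG : ι G ≠ 0 := (map_ne_zero_iff _ hinj).2 hG₀
  let q : Polynomial K := aeval ![Polynomial.X, 1] Q
  have hq₀ : q ≠ 0 := fun h => hQ₀ <| by
    rw [← Polynomial.homogenize_eq_of_isHomogeneous hQ h, Polynomial.homogenize_zero]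
  have hroot : Polynomial.aeval (ι F / ι G) q = 0 := by
    rw [algHom_aeval_pair, Polynomial.aeval_X, map_one]
    refine (mul_eq_zero.1 ?_).resolve_left (pow_ne_zero N hιG)
    rw [← aeval_pair_mul_left hQ, mul_div_cancel₀ _ hιG, mul_one, ← algHom_aeval_pair, hQFG,
      map_zero]
  obtain ⟨c, hc₀, rfl⟩ := exists_eq_C_mul_of_isAlgebraic_div hF hG hF₀ hG₀ ⟨q, hq₀, hroot⟩
  refine ⟨c, hc₀, rfl, X_sub_C_mul_X_dvd_of_aeval_eq_zero hQ ?_⟩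
  have hmul : G ^ N * C (aeval ![c, 1] Q) = 0 := by
    rw [← hQFG, ← algebraMap_eq, ← Algebra.ofId_apply, algHom_aeval_pair, ← aeval_pair_mul_left hQ,
      map_one, mul_one, mul_comm]
    rfl
  exact C_eq_zero.1 ((mul_eq_zero.1 hmul).resolve_left (pow_ne_zero N hG₀))

end BinaryForms

theorem mod_eq_mod_and_div_add_div_eq_of_coprime {a b x y x' y' : ℕ} (ha : 0 < a)
    (hb : 0 < b) (hab : a.Coprime b) (h : x * b + y * a = x' * b + y' * a) :
    x % a = x' % a ∧ y % b = y' % b ∧ x / a + y / b = x' / a + y' / b := by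
  have hx : x % a = x' % a := by
    refine Nat.ModEq.cancel_right_of_coprime hab (c := b) ?_
    simpa [Nat.ModEq] using congrArg (· % a) h
  have hy : y % b = y' % b := by
    refine Nat.ModEq.cancel_right_of_coprime hab.symm (c := a) ?_
    simpa [Nat.ModEq] using congrArg (· % b) h
  refine ⟨hx, hy, Nat.eq_of_mul_eq_mul_left (Nat.mul_pos ha hb) ?_⟩
  rw [← Nat.div_add_mod x a, ← Nat.div_add_mod y b, ← Nat.div_add_mod x' a,
    ← Nat.div_add_mod y' b, hx, hy] at h
  linarith

theorem exists_monomial_mul_bind₁_pow {p : MvPolynomial (Fin 2) K} (hp : p ≠ 0) {a b m : ℕ}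
    (ha : 0 < a) (hb : 0 < b) (hab : a.Coprime b) (hweight : IsWeightedHomogeneous ![b, a] p m) :
    ∃ (i j N : ℕ) (Q : MvPolynomial (Fin 2) K), Q.IsHomogeneous N ∧
      p = X 0 ^ i * X 1 ^ j * bind₁ ![X 0 ^ a, X 1 ^ b] Q := by
  obtain ⟨d₀, hd₀⟩ := support_nonempty.2 hp
  have weight_eq {d : Fin 2 →₀ ℕ} (hd : d ∈ p.support) : d 0 * b + d 1 * a = m := by
    rw [← hweight (mem_support_iff.1 hd), Finsupp.weight_apply,
      Finsupp.sum_fintype _ _ (by simp), Fin.sum_univ_two]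
    rfl
  have hdiv (d) (hd : d ∈ p.support) :=
    mod_eq_mod_and_div_add_div_eq_of_coprime ha hb hab ((weight_eq hd).trans (weight_eq hd₀).symm)
  refine ⟨d₀ 0 % a, d₀ 1 % b, d₀ 0 / a + d₀ 1 / b,
    ∑ d ∈ p.support, C (p.coeff d) * (X 0 ^ (d 0 / a) * X 1 ^ (d 1 / b)), ?_, ?_⟩
  · refine IsHomogeneous.sum _ _ _ fun d hd => ?_
    rw [← (hdiv d hd).2.2]
    exact ((isHomogeneous_X_pow 0 _).mul (isHomogeneous_X_pow 1 _)).C_mul _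
  · conv_lhs => rw [p.as_sum]
    rw [map_sum, Finset.mul_sum]
    refine Finset.sum_congr rfl fun d hd => ?_
    rw [← (hdiv d hd).1, ← (hdiv d hd).2.1, monomial_eq,
      Finsupp.prod_fintype _ _ fun i => pow_zero _, Fin.prod_univ_two]
    conv_lhs => rw [← Nat.mod_add_div (d 0) a, ← Nat.mod_add_div (d 1) b]
    simp only [map_mul, map_pow, bind₁_C_right, bind₁_X_right, Matrix.cons_val_zero,
      Matrix.cons_val_one, pow_add, pow_mul]
    ring

theorem exists_binomial_dvd {p : MvPolynomial (Fin 2) K} (hp : p ≠ 0) {a b m : ℕ}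
    (ha : 0 < a) (hb : 0 < b) (hab : a.Coprime b) (hweight : IsWeightedHomogeneous ![b, a] p m)
    {F G : MvPolynomial σ K} {e : ℕ} (hF : F.IsHomogeneous (e * b)) (hG : G.IsHomogeneous (e * a))
    (hF₀ : F ≠ 0) (hG₀ : G ≠ 0) (hpFG : bind₁ ![F, G] p = 0) :
    ∃ c : K, c ≠ 0 ∧ F ^ a = C c * G ^ b ∧ X 0 ^ a - C c * X 1 ^ b ∣ p := by
  obtain ⟨i, j, N, Q, hQ, rfl⟩ := exists_monomial_mul_bind₁_pow hp ha hb hab hweight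
  have hQFG : aeval ![F ^ a, G ^ b] Q = 0 := by
    rw [map_mul, map_mul, map_pow, map_pow, bind₁_X_right, bind₁_X_right] at hpFG
    have hmonomial : F ^ i * G ^ j ≠ 0 := mul_ne_zero (pow_ne_zero i hF₀) (pow_ne_zero j hG₀)
    have := (mul_eq_zero.1 hpFG).resolve_left hmonomial
    rwa [bind₁, bind₁, algHom_aeval_pair, map_pow, map_pow, aeval_X, aeval_X] at this
  have hQ₀ : Q ≠ 0 := by
    rintro rfl
    exact hp (by rw [map_zero, mul_zero])
  have hGpow : (G ^ b).IsHomogeneous (e * b * a) := mul_right_comm e a b ▸ hG.pow b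
  obtain ⟨c, hc, hFG, hdvd⟩ := exists_X_sub_C_mul_X_dvd hQ hQ₀ (hF.pow a) hGpow
    (pow_ne_zero a hF₀) (pow_ne_zero b hG₀) hQFG
  refine ⟨c, hc, hFG, Dvd.dvd.mul_left ?_ _⟩
  simpa only [map_sub, map_mul, bind₁_C_right, bind₁_X_right, Matrix.cons_val_zero,
    Matrix.cons_val_one] using
    map_dvd (bind₁ ![X 0 ^ a, X 1 ^ b]) hdvd

end BinomialDivisor

section TopForm

open MvPolynomial

variable {σ R : Type*} [CommSemiring R]

/-- The homogeneous component of highest degree of a polynomial. -/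
noncomputable def topForm (p : MvPolynomial σ R) : MvPolynomial σ R :=
  homogeneousComponent p.totalDegree p

theorem hasLeadingForm_one_of_totalDegree_le {p : MvPolynomial σ R} {n : ℕ}
    (h : p.totalDegree ≤ n) : HasLeadingForm 1 n p (homogeneousComponent n p) :=
  ⟨fun d hd => (DFunLike.congr_fun Finsupp.degree_eq_weight_one d).ge.trans
    ((le_totalDegree hd).trans h), rfl⟩

theorem hasLeadingForm_topForm (p : MvPolynomial σ R) :
    HasLeadingForm 1 p.totalDegree p (topForm p) :=
  hasLeadingForm_one_of_totalDegree_le le_rfl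

theorem HasLeadingForm.totalDegree_lt {p : MvPolynomial σ R} {n : ℕ} (hn : 0 < n)
    (h : HasLeadingForm 1 n p 0) : p.totalDegree < n := by
  refine (Finset.sup_lt_iff hn).2 fun d hd => ?_
  change d.degree < n
  rw [Finsupp.degree_eq_weight_one]
  refine (h.weight_le d hd).lt_of_ne fun heq => mem_support_iff.1 hd ?_
  rw [← h.coeff_eq heq, coeff_zero]

theorem topForm_ne_zero {p : MvPolynomial σ R} (hp : 0 < p.totalDegree) : topForm p ≠ 0 :=
  fun h => ((h ▸ hasLeadingForm_topForm p).totalDegree_lt hp).false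

theorem totalDegree_sub_C_mul_pow_lt {R : Type*} [CommRing R] {p q : MvPolynomial σ R} {c : R}
    {r : ℕ} (hp : 0 < p.totalDegree) (hdegree : p.totalDegree = r * q.totalDegree)
    (hform : topForm p = C c * topForm q ^ r) :
    (p - C c * q ^ r).totalDegree < p.totalDegree := by
  have hq : HasLeadingForm 1 p.totalDegree (C (-c) * q ^ r) (C (-c) * topForm q ^ r) := by
    rw [hdegree, ← smul_eq_mul]
    exact ((hasLeadingForm_topForm q).pow r).C_mul (-c)
  have hsub := (hasLeadingForm_topForm p).add hq
  rw [hform, C_neg, neg_mul, neg_mul, add_neg_cancel, ← sub_eq_add_neg] at hsub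
  exact hsub.totalDegree_lt hp

theorem exists_hasLeadingForm_of_mem_support {M : Type*} [AddCommMonoid M] [LinearOrder M]
    (w : σ → M) {p : MvPolynomial σ R} {d : σ →₀ ℕ} (hd : d ∈ p.support) :
    ∃ (a : M) (P : MvPolynomial σ R), Finsupp.weight w d ≤ a ∧ HasLeadingForm w a p P ∧ P ≠ 0 := by
  obtain ⟨d₀, hd₀, hmax⟩ := p.support.exists_max_image (Finsupp.weight w) ⟨d, hd⟩
  have hlead : HasLeadingForm w (Finsupp.weight w d₀) p _ := ⟨hmax, rfl⟩
  refine ⟨_, _, hmax d hd, hlead, fun h => mem_support_iff.1 hd₀ ?_⟩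
  rw [← hlead.coeff_eq rfl, h, coeff_zero]

theorem bind₁_eq_self_of_eq_X_on_vars {f : σ → MvPolynomial σ R} {p : MvPolynomial σ R}
    (h : ∀ i ∈ p.vars, f i = X i) : bind₁ f p = p := by
  conv_rhs => rw [← AlgHom.id_apply (R := R) p, ← bind₁_X_left]
  exact eval₂Hom_congr' rfl (fun i hi _ => h i hi) rfl

theorem exists_isWeightedHomogeneous_of_smul {w : σ → ℕ} {e m : ℕ} (he : e ≠ 0)
    {p : MvPolynomial σ R} (hp : IsWeightedHomogeneous (e • w) p m) :
    ∃ m', IsWeightedHomogeneous w p m' := by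
  have hweight (d : σ →₀ ℕ) : Finsupp.weight (e • w) d = e * Finsupp.weight w d := by
    simp only [Finsupp.weight_apply, Finsupp.sum, Pi.smul_apply, smul_eq_mul, Finset.mul_sum,
      mul_left_comm]
  obtain rfl | ⟨d₀, hd₀⟩ := p.support.eq_empty_or_nonempty.imp_left support_eq_empty.1
  · exact ⟨0, isWeightedHomogeneous_zero R w 0⟩
  · refine ⟨Finsupp.weight w d₀, fun d hd => mul_left_cancel₀ he ?_⟩
    rw [← hweight, ← hweight, hp hd, hp (mem_support_iff.1 hd₀)]

end TopForm

namespace AffineEnd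

open MvPolynomial

variable {K : Type*} [Field K] {n : ℕ}

theorem exists_one_lt_weight (φ : (AffineEnd K n)ˣ) (hφ : 1 < φ.1.degree) :
    ∃ i, ∃ d ∈ ((φ⁻¹).1.coord i).support,
      1 < Finsupp.weight (fun k => (φ.1.coord k).totalDegree) d := by
  by_contra! h
  obtain ⟨j, -, hj⟩ := Finset.lt_sup_iff.1 hφ
  have hvars (i : Fin n) : j ∉ ((φ⁻¹).1.coord i).vars := by
    rw [mem_vars_iff_mem_support]
    rintro ⟨d, hd, hdj⟩
    exact (hj.trans_le (Finsupp.le_weight_of_ne_zero'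
      (fun k => (φ.1.coord k).totalDegree)
      (Finsupp.mem_support_iff.1 hdj))).not_ge (h i d hd)
  have hbind (i : Fin n) :
      bind₁ (Function.update X j 0) ((φ⁻¹).1.coord i) = (φ⁻¹).1.coord i :=
    bind₁_eq_self_of_eq_X_on_vars fun k hk => Function.update_of_ne
      (ne_of_mem_of_not_mem hk (hvars i)) _ _
  have hX := congrArg (bind₁ (Function.update X j 0)) (bind₁_inv_coord φ j)
  rw [bind₁_bind₁, bind₁_X_right, Function.update_self] at hX
  simp only [hbind] at hX
  rw [bind₁_inv_coord] at hX
  exact X_ne_zero j hX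

theorem exists_topForm_relation (φ : (AffineEnd K n)ˣ) (hφ : 1 < φ.1.degree) :
    ∃ (i : Fin n) (N : ℕ) (P : MvPolynomial (Fin n) K),
      HasLeadingForm (fun k => (φ.1.coord k).totalDegree) N ((φ⁻¹).1.coord i) P ∧ P ≠ 0 ∧
        bind₁ (fun k => topForm (φ.1.coord k)) P = 0 := by
  obtain ⟨i, d, hd, hlt⟩ := exists_one_lt_weight φ hφ
  obtain ⟨N, P, hN, hP, hP₀⟩ := exists_hasLeadingForm_of_mem_support
    (fun k => (φ.1.coord k).totalDegree) hd
  refine ⟨i, N, P, hP, hP₀, ?_⟩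
  have hbind := HasLeadingForm.bind₁ (fun k => hasLeadingForm_topForm (φ.1.coord k)) hP
  rw [bind₁_coord_inv] at hbind
  have hX : HasLeadingForm 1 1 (X i : MvPolynomial (Fin n) K) (X i) :=
    .of_isWeightedHomogeneous (isWeightedHomogeneous_X K 1 i)
  rw [← hbind.component_eq, (hX.zero_of_lt (hlt.trans_le hN)).component_eq]

theorem exists_topForm_eq_C_mul_pow (φ : (AffineEnd K 2)ˣ) (hφ : 1 < φ.1.degree) :
    ∃ i j : Fin 2, i ≠ j ∧ ∃ (c : K) (r : ℕ),
      (φ.1.coord i).totalDegree = r * (φ.1.coord j).totalDegree ∧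
        topForm (φ.1.coord i) = C c * topForm (φ.1.coord j) ^ r := by
  obtain ⟨i, N, P, hP, hP₀, hrelation⟩ := exists_topForm_relation φ hφ
  obtain ⟨e, b, a, he, hba, hdeg₀, hdeg₁⟩ :=
    Nat.exists_coprime'
      (Nat.gcd_pos_of_pos_left (φ.1.coord 1).totalDegree (totalDegree_coord_pos φ 0))
  have hb : 0 < b := Nat.pos_of_mul_pos_right (hdeg₀ ▸ totalDegree_coord_pos φ 0)
  have ha : 0 < a := Nat.pos_of_mul_pos_right (hdeg₁ ▸ totalDegree_coord_pos φ 1)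
  have hhomogeneous (k : Fin 2) :
      (topForm (φ.1.coord k)).IsHomogeneous (φ.1.coord k).totalDegree :=
    homogeneousComponent_isHomogeneous _ _
  have hweights : (fun k => (φ.1.coord k).totalDegree) = e • ![b, a] := by
    funext k
    fin_cases k
    exacts [hdeg₀.trans (mul_comm b e), hdeg₁.trans (mul_comm a e)]
  have hforms : (fun k => topForm (φ.1.coord k)) =
      ![topForm (φ.1.coord 0), topForm (φ.1.coord 1)] := by
    funext k
    fin_cases k <;> rfl
  have hPweight : ∃ m, IsWeightedHomogeneous ![b, a] P m :=
    exists_isWeightedHomogeneous_of_smul he.ne' (hweights ▸ hP.isWeightedHomogeneous)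
  obtain ⟨m, hm⟩ := hPweight
  obtain ⟨c, hc, hpow, hdvd⟩ := exists_binomial_dvd hP₀ ha hb hba.symm hm
    (mul_comm b e ▸ hdeg₀ ▸ hhomogeneous 0) (mul_comm a e ▸ hdeg₁ ▸ hhomogeneous 1)
    (topForm_ne_zero (totalDegree_coord_pos φ 0)) (topForm_ne_zero (totalDegree_coord_pos φ 1))
    (hforms ▸ hrelation)
  obtain ⟨j, hji⟩ := exists_ne i
  have hinvariant : bind₁ (translationFlow φ j) ((φ⁻¹).1.coord i) =
      rename some ((φ⁻¹).1.coord i) := by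
    rw [bind₁_translationFlow, if_neg hji.symm, add_zero]
  have hexponents := not_two_le_of_deformation (specializeZero_translationFlow φ j)
    (exists_degreeOf_translationFlow_ne_zero φ j) (hP.natCast (𝕜 := ℚ)) hP₀ hinvariant hba.symm hc
    hdvd
  obtain rfl | rfl : a = 1 ∨ b = 1 := by omega
  · refine ⟨0, 1, zero_ne_one, c, b, by rw [hdeg₀, hdeg₁, one_mul], ?_⟩
    rw [← hpow, pow_one]
  · refine ⟨1, 0, one_ne_zero, c⁻¹, a, by rw [hdeg₀, hdeg₁, one_mul], ?_⟩
    rw [hpow, pow_one, ← mul_assoc, ← C_mul, inv_mul_cancel₀ hc, C_1, one_mul]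

theorem exists_totalDegree_sub_lt (φ : (AffineEnd K 2)ˣ) (hφ : 1 < φ.1.degree) :
    ∃ i j : Fin 2, i ≠ j ∧ ∃ (c : K) (r : ℕ),
      (φ.1.coord i - C c * φ.1.coord j ^ r).totalDegree < (φ.1.coord i).totalDegree := by
  obtain ⟨i, j, hij, c, r, hdegree, hform⟩ := exists_topForm_eq_C_mul_pow φ hφ
  exact ⟨i, j, hij, c, r, totalDegree_sub_C_mul_pow_lt (totalDegree_coord_pos φ i) hdegree hform⟩

end AffineEnd

section

open MvPolynomial

theorem totalDegree_aeval_polynomial_le {σ R : Type*} [CommSemiring R] (p : MvPolynomial σ R)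
    (Q : Polynomial R) : (Polynomial.aeval p Q).totalDegree ≤ Q.natDegree * p.totalDegree := by
  rw [Polynomial.aeval_eq_sum_range]
  refine totalDegree_finsetSum_le fun j hj => (totalDegree_smul_le _ _).trans ?_
  exact (totalDegree_pow _ _).trans
    (Nat.mul_le_mul_right _ (Finset.mem_range_succ_iff.1 hj))

end

namespace AffineEnd

open MvPolynomial

variable {K : Type*} [Field K] {n : ℕ}

theorem degree_pos (φ : (AffineEnd K (n + 1))ˣ) : 0 < φ.1.degree :=
  (totalDegree_coord_pos φ 0).trans_le (totalDegree_coord_le φ.1 0)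

theorem degree_le_iff {f : AffineEnd K n} {d : ℕ} :
    f.degree ≤ d ↔ ∀ i, (f.coord i).totalDegree ≤ d := by
  simp only [degree, Finset.sup_le_iff, Finset.mem_univ, true_imp_iff]

theorem degree_one_le : (1 : AffineEnd K n).degree ≤ 1 :=
  degree_le_iff.2 fun i => by rw [coord_one, totalDegree_X]

variable (K n) in
/-- The affine automorphisms of `𝔸ⁿ`, as the automorphisms of degree at most `1`. Only the
submonoid structure is recorded, since closure under inversion plays no role. -/
def affineSubmonoid : Submonoid (AffineEnd K n)ˣ where
  carrier := {φ | φ.1.degree ≤ 1}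
  one_mem' := degree_one_le
  mul_mem' {φ ψ} hφ hψ := (degree_mul_le φ.1 ψ.1).trans (Nat.mul_le_mul hφ hψ)

/-- The triangular endomorphisms `(a x + Q(y), b y + c)` of the plane with `deg Q ≤ d`. The bound
`d` does not grow under composition. -/
def IsTriangular (d : ℕ) (f : AffineEnd K 2) : Prop :=
  ∃ (a b c : K) (Q : Polynomial K), Q.natDegree ≤ d ∧
    f.coord 0 = C a * X 0 + Polynomial.aeval (X 1) Q ∧ f.coord 1 = C b * X 1 + C c

theorem isTriangular_one : IsTriangular 0 (1 : AffineEnd K 2) :=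
  ⟨1, 1, 0, 0, Polynomial.natDegree_zero.le, by rw [coord_one, C_1, one_mul, map_zero, add_zero],
    by rw [coord_one, C_1, C_0, one_mul, add_zero]⟩

theorem IsTriangular.mono {d e : ℕ} (h : d ≤ e) {f : AffineEnd K 2} (hf : IsTriangular d f) :
    IsTriangular e f := by
  obtain ⟨a, b, c, Q, hQ, hf⟩ := hf
  exact ⟨a, b, c, Q, hQ.trans h, hf⟩

theorem IsTriangular.mul {d : ℕ} {f g : AffineEnd K 2} (hf : IsTriangular d f)
    (hg : IsTriangular d g) : IsTriangular d (f * g) := by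
  obtain ⟨a, b, c, Q, hQ, hf₀, hf₁⟩ := hf
  obtain ⟨a', b', c', Q', hQ', hg₀, hg₁⟩ := hg
  refine ⟨a * a', b * b', b * c' + c, Polynomial.C a * Q' +
    Q.comp (Polynomial.C b' * Polynomial.X + Polynomial.C c'), ?_, ?_, ?_⟩
  · refine (Polynomial.natDegree_add_le _ _).trans (max_le ?_ ?_)
    · exact (Polynomial.natDegree_C_mul_le _ _).trans hQ'
    · refine Polynomial.natDegree_comp_le.trans ?_
      exact (Nat.mul_le_mul hQ Polynomial.natDegree_linear_le).trans (mul_one d).le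
  · rw [coord_mul, hf₀, map_add, map_mul, bind₁_C_right, bind₁_X_right, hg₀,
      ← Polynomial.aeval_algHom_apply, bind₁_X_right, hg₁, map_add,
      map_mul (Polynomial.aeval _), Polynomial.aeval_C, Polynomial.aeval_comp]
    simp only [map_add, map_mul, Polynomial.aeval_C, Polynomial.aeval_X, algebraMap_eq]
    ring
  · rw [coord_mul, hf₁, map_add, map_mul, bind₁_C_right, bind₁_C_right, bind₁_X_right, hg₁]
    simp only [C_mul, C_add]
    ring

theorem IsTriangular.degree_le {d : ℕ} {f : AffineEnd K 2} (hf : IsTriangular d f) :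
    f.degree ≤ max d 1 := by
  obtain ⟨a, b, c, Q, hQ, hf₀, hf₁⟩ := hf
  have hlinear (r : K) (i : Fin 2) : (C r * X i : MvPolynomial (Fin 2) K).totalDegree ≤ 1 := by
    refine (totalDegree_mul _ _).trans ?_
    rw [totalDegree_C, totalDegree_X]
  have haeval : (Polynomial.aeval (X 1 : MvPolynomial (Fin 2) K) Q).totalDegree ≤ d := by
    refine (totalDegree_aeval_polynomial_le _ Q).trans ?_
    rwa [totalDegree_X, mul_one]
  refine degree_le_iff.2 (Fin.forall_fin_two.2 ⟨?_, ?_⟩)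
  · rw [hf₀]
    exact (totalDegree_add _ _).trans (max_le ((hlinear a 0).trans (le_max_right _ _))
      (haeval.trans (le_max_left _ _)))
  · rw [hf₁]
    refine (totalDegree_add _ _).trans (max_le ((hlinear b 1).trans (le_max_right _ _)) ?_)
    exact (totalDegree_C c).trans_le (Nat.zero_le _)

variable (K) in
/-- The triangular automorphisms of the plane, again only as a submonoid. -/
def triangularSubmonoid : Submonoid (AffineEnd K 2)ˣ where
  carrier := {φ | ∃ d, IsTriangular d φ.1}
  one_mem' := ⟨0, isTriangular_one⟩
  mul_mem' := by
    rintro φ ψ ⟨d, hd⟩ ⟨e, he⟩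
    exact ⟨max d e, (hd.mono (le_max_left _ _)).mul (he.mono (le_max_right _ _))⟩

/-- The elementary endomorphism `(x + Q(y), y)` of the plane. -/
noncomputable def elementaryEnd (Q : Polynomial K) : AffineEnd K 2 :=
  ⟨![X 0 + Polynomial.aeval (X 1) Q, X 1]⟩

theorem elementaryEnd_mul_elementaryEnd_neg (Q : Polynomial K) :
    elementaryEnd Q * elementaryEnd (-Q) = 1 := by
  refine AffineEnd.ext (funext (Fin.forall_fin_two.2 ⟨?_, bind₁_X_right _ _⟩))
  change bind₁ (elementaryEnd (-Q)).coord (X 0 + Polynomial.aeval (X 1) Q) = X 0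
  rw [map_add, bind₁_X_right, ← Polynomial.aeval_algHom_apply, bind₁_X_right]
  change X 0 + Polynomial.aeval (X 1) (-Q) + Polynomial.aeval (X 1) Q = X 0
  rw [map_neg, neg_add_cancel_right]

/-- The elementary automorphism `(x + Q(y), y)` of the plane. -/
noncomputable def elementary (Q : Polynomial K) : (AffineEnd K 2)ˣ where
  val := elementaryEnd Q
  inv := elementaryEnd (-Q)
  val_inv := elementaryEnd_mul_elementaryEnd_neg Q
  inv_val := by simpa only [neg_neg] using elementaryEnd_mul_elementaryEnd_neg (-Q)

theorem elementary_inv_mem (Q : Polynomial K) : (elementary Q)⁻¹ ∈ triangularSubmonoid K :=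
  ⟨_, 1, 1, 0, -Q, le_rfl, by rw [C_1, one_mul]; rfl, by rw [C_1, C_0, one_mul, add_zero]; rfl⟩

theorem elementary_mul_coord_zero (Q : Polynomial K) (φ : (AffineEnd K 2)ˣ) :
    (elementary Q * φ).1.coord 0 = φ.1.coord 0 + Polynomial.aeval (φ.1.coord 1) Q := by
  change bind₁ φ.1.coord (X 0 + Polynomial.aeval (X 1) Q) = _
  rw [map_add, bind₁_X_right, ← Polynomial.aeval_algHom_apply, bind₁_X_right]

theorem elementary_mul_coord_one (Q : Polynomial K) (φ : (AffineEnd K 2)ˣ) :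
    (elementary Q * φ).1.coord 1 = φ.1.coord 1 :=
  bind₁_X_right _ _

variable (K) in
/-- The automorphism `(y, x)` of the plane. -/
noncomputable def swap : (AffineEnd K 2)ˣ where
  val := ⟨![X 1, X 0]⟩
  inv := ⟨![X 1, X 0]⟩
  val_inv := AffineEnd.ext (funext (Fin.forall_fin_two.2 ⟨bind₁_X_right _ _, bind₁_X_right _ _⟩))
  inv_val := AffineEnd.ext (funext (Fin.forall_fin_two.2 ⟨bind₁_X_right _ _, bind₁_X_right _ _⟩))

theorem swap_inv_mem : (swap K)⁻¹ ∈ affineSubmonoid K 2 :=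
  degree_le_iff.2 (Fin.forall_fin_two.2 ⟨(totalDegree_X (R := K) (1 : Fin 2)).le,
    (totalDegree_X (R := K) (0 : Fin 2)).le⟩)

theorem exists_sum_totalDegree_coord_lt (φ : (AffineEnd K 2)ˣ) (hφ : 1 < φ.1.degree) :
    ∃ τ : (AffineEnd K 2)ˣ, τ⁻¹ ∈ affineSubmonoid K 2 ⊔ triangularSubmonoid K ∧
      ∑ i, ((τ * φ).1.coord i).totalDegree < ∑ i, (φ.1.coord i).totalDegree := by
  obtain ⟨i, j, hij, c, r, hlt⟩ := exists_totalDegree_sub_lt φ hφ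
  set θ := elementary (-(Polynomial.C c * Polynomial.X ^ r)) with hθ
  have hθmem : θ⁻¹ ∈ affineSubmonoid K 2 ⊔ triangularSubmonoid K :=
    Submonoid.mem_sup_right (elementary_inv_mem _)
  have hθ₀ (ψ : (AffineEnd K 2)ˣ) :
      (θ * ψ).1.coord 0 = ψ.1.coord 0 - C c * ψ.1.coord 1 ^ r := by
    rw [hθ, elementary_mul_coord_zero, map_neg, map_mul, map_pow, Polynomial.aeval_C,
      Polynomial.aeval_X, algebraMap_eq, sub_eq_add_neg]
  obtain ⟨rfl, rfl⟩ | ⟨rfl, rfl⟩ : (i = 0 ∧ j = 1) ∨ (i = 1 ∧ j = 0) := by omega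
  · refine ⟨θ, hθmem, ?_⟩
    rw [Fin.sum_univ_two, Fin.sum_univ_two, hθ₀, elementary_mul_coord_one]
    exact Nat.add_lt_add_right hlt _
  · have hswap₀ : (swap K * φ).1.coord 0 = φ.1.coord 1 := bind₁_X_right _ _
    have hswap₁ : (swap K * φ).1.coord 1 = φ.1.coord 0 := bind₁_X_right _ _
    refine ⟨θ * swap K, ?_, ?_⟩
    · rw [mul_inv_rev]
      exact mul_mem (Submonoid.mem_sup_left swap_inv_mem) hθmem
    · rw [Fin.sum_univ_two, Fin.sum_univ_two, mul_assoc, hθ₀, elementary_mul_coord_one, hswap₀,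
        hswap₁, add_comm]
      exact Nat.add_lt_add_left hlt _

/-- The theorem of Jung and van der Kulk. -/
theorem affineSubmonoid_sup_triangularSubmonoid :
    affineSubmonoid K 2 ⊔ triangularSubmonoid K = ⊤ := by
  refine eq_top_iff.2 fun φ _ => ?_
  induction hN : ∑ i, (φ.1.coord i).totalDegree using Nat.strong_induction_on generalizing φ with
  | h N ih =>
    by_cases hφ : φ.1.degree ≤ 1
    · exact Submonoid.mem_sup_left hφ
    · obtain ⟨τ, hτ, hlt⟩ := exists_sum_totalDegree_coord_lt φ (not_le.1 hφ)
      simpa only [inv_mul_cancel_left] using mul_mem hτ (ih _ (hN ▸ hlt) (τ * φ) trivial rfl)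

end AffineEnd

section TwistedConjugacy

open scoped Pointwise

variable {G : Type*} [Group G] {A B : Submonoid G} {s : G →* G} {g h x : G} {n : ℕ}

/-- Two elements are twisted conjugate by `s` if they are related by `g ↦ s θ * g * θ⁻¹`. -/
def IsTwistedConj (s : G →* G) (g h : G) : Prop :=
  ∃ θ : G, s θ * g * θ⁻¹ = h

theorem IsTwistedConj.refl (s : G →* G) (g : G) : IsTwistedConj s g g :=
  ⟨1, by rw [map_one, one_mul, inv_one, mul_one]⟩

theorem IsTwistedConj.trans {k : G} (hgh : IsTwistedConj s g h) (hhk : IsTwistedConj s h k) :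
    IsTwistedConj s g k := by
  obtain ⟨θ, rfl⟩ := hgh
  obtain ⟨η, rfl⟩ := hhk
  exact ⟨η * θ, by simp only [map_mul, mul_inv_rev, mul_assoc]⟩

theorem isTwistedConj_mul_map_mul (s : G →* G) (u v : G) : IsTwistedConj s (u * v) (s v * u) :=
  ⟨v, by rw [mul_assoc, mul_inv_cancel_right]⟩

/-- The products of elements `b * a` with `b ∈ B \ A` and `a ∈ A \ B`. -/
def alternatingSubsemigroup (A B : Submonoid G) : Subsemigroup G :=
  Subsemigroup.closure {g | ∃ b a, b ∈ B ∧ b ∉ A ∧ a ∈ A ∧ a ∉ B ∧ g = b * a}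

theorem exists_mem_mul_pow_of_sup_eq_top (hsup : A ⊔ B = ⊤) (g : G) :
    ∃ n, g ∈ ((B : Set G) * A) ^ n := by
  have hg : g ∈ A ⊔ B := hsup ▸ Submonoid.mem_top g
  rw [Submonoid.sup_eq_closure] at hg
  induction hg using Submonoid.closure_induction with
  | one => exact ⟨0, by rw [pow_zero]; exact Set.one_mem_one⟩
  | mem g hg =>
    refine ⟨1, (pow_one ((B : Set G) * A)).symm ▸ ?_⟩
    obtain hg | hg := hg
    · exact ⟨1, B.one_mem, g, hg, one_mul g⟩
    · exact ⟨g, hg, 1, A.one_mem, mul_one g⟩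
  | mul g g' _ _ hg hg' =>
    obtain ⟨n, hn⟩ := hg
    obtain ⟨n', hn'⟩ := hg'
    exact ⟨n + n', pow_add ((B : Set G) * A) n n' ▸ Set.mul_mem_mul hn hn'⟩

theorem map_mem_mul_pow (hA : ∀ a ∈ A, s a ∈ A) (hB : ∀ b ∈ B, s b ∈ B)
    (hx : x ∈ ((B : Set G) * A) ^ n) : s x ∈ ((B : Set G) * A) ^ n := by
  have himage : s '' ((B : Set G) * A) ⊆ B * A := by
    rw [Set.image_mul]
    exact Set.mul_subset_mul (Set.image_subset_iff.2 hB) (Set.image_subset_iff.2 hA)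
  exact Set.pow_subset_pow_left himage (Set.image_pow s _ n ▸ Set.mem_image_of_mem s hx)

theorem mem_alternatingSubsemigroup_or_exists_eq_mul (hx : x ∈ ((B : Set G) * A) ^ (n + 1)) :
    x ∈ alternatingSubsemigroup A B ∨ ∃ i j, i + j = n ∧ ∃ u ∈ ((B : Set G) * A) ^ i,
      ∃ v ∈ ((B : Set G) * A) ^ j, ∃ b ∈ B, ∃ a ∈ A, (b ∈ A ∨ a ∈ B) ∧ x = u * (b * a) * v := by
  induction n generalizing x with
  | zero =>
    rw [zero_add, pow_one] at hx
    obtain ⟨b, hb, a, ha, rfl⟩ := hx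
    by_cases hba : b ∈ A ∨ a ∈ B
    · exact .inr ⟨0, 0, rfl, 1, rfl, 1, rfl, b, hb, a, ha, hba, by simp only [one_mul, mul_one]⟩
    · exact .inl (Subsemigroup.subset_closure
        ⟨b, a, hb, fun h => hba (.inl h), ha, fun h => hba (.inr h), rfl⟩)
  | succ n ih =>
    rw [pow_succ] at hx
    obtain ⟨y, hy, _, ⟨b, hb, a, ha, rfl⟩, rfl⟩ := hx
    by_cases hba : b ∈ A ∨ a ∈ B
    · exact .inr ⟨n + 1, 0, rfl, y, hy, 1, rfl, b, hb, a, ha, hba, (mul_one _).symm⟩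
    obtain hy | ⟨i, j, rfl, u, hu, v, hv, b', hb', a', ha', hba', rfl⟩ := ih hy
    · exact .inl (mul_mem hy (Subsemigroup.subset_closure
        ⟨b, a, hb, fun h => hba (.inl h), ha, fun h => hba (.inr h), rfl⟩))
    · refine .inr ⟨i, j + 1, rfl, u, hu, v * (b * a), ?_, b', hb', a', ha', hba', mul_assoc _ _ _⟩
      exact pow_succ ((B : Set G) * A) j ▸ Set.mul_mem_mul hv ⟨b, hb, a, ha, rfl⟩

theorem mul_mem_mul_pow_succ {a : G} (hx : x ∈ ((B : Set G) * A) ^ (n + 1)) (ha : a ∈ A) :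
    x * a ∈ ((B : Set G) * A) ^ (n + 1) := by
  rw [pow_succ, ← mul_assoc] at hx ⊢
  have hxa := Set.mul_mem_mul hx ha
  rwa [mul_assoc _ (A : Set G) A, A.coe_mul_self_eq] at hxa

theorem mem_mul_mul_pow_succ {b : G} (hb : b ∈ B) (hx : x ∈ ((B : Set G) * A) ^ (n + 1)) :
    b * x ∈ ((B : Set G) * A) ^ (n + 1) := by
  rw [pow_succ', mul_assoc] at hx ⊢
  have hbx := Set.mul_mem_mul hb hx
  rwa [← mul_assoc (B : Set G) B, B.coe_mul_self_eq] at hbx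

/-- If a product of `n` factors in `B * A` is not alternating, one of its factors lies in `A` or in
`B`. Twisted conjugation moves this factor to the end, where it is absorbed by its neighbour. -/
theorem exists_isTwistedConj_of_mem_mul_pow (hA : ∀ a ∈ A, s a ∈ A) (hB : ∀ b ∈ B, s b ∈ B)
    (hg : g ∈ ((B : Set G) * A) ^ n) :
    ∃ h, IsTwistedConj s g h ∧ (h ∈ A ∨ h ∈ B ∨ h ∈ alternatingSubsemigroup A B) := by
  induction n generalizing g with
  | zero =>
    rw [pow_zero, Set.mem_one] at hg
    exact ⟨g, .refl s g, .inl (hg ▸ A.one_mem)⟩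
  | succ n ih =>
    obtain hg | ⟨i, j, hij, u, hu, v, hv, b, hb, a, ha, hba, rfl⟩ :=
      mem_alternatingSubsemigroup_or_exists_eq_mul hg
    · exact ⟨g, .refl s g, .inr (.inr hg)⟩
    set w := s v * u
    have hwmem : w ∈ ((B : Set G) * A) ^ n := by
      rw [← hij, add_comm, pow_add]
      exact Set.mul_mem_mul (map_mem_mul_pow hA hB hv) hu
    have hconj : IsTwistedConj s (u * (b * a) * v) (w * (b * a)) :=
      mul_assoc (s v) u (b * a) ▸ isTwistedConj_mul_map_mul s _ v
    obtain _ | n := n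
    · rw [pow_zero, Set.mem_one] at hwmem
      rw [hwmem, one_mul] at hconj
      exact ⟨_, hconj, hba.imp (fun h => mul_mem h ha) fun h => .inl (mul_mem hb h)⟩
    obtain hbA | haB := hba
    · obtain ⟨h, hwh, hh⟩ := ih (mul_mem_mul_pow_succ hwmem (mul_mem hbA ha))
      exact ⟨h, hconj.trans hwh, hh⟩
    · obtain ⟨h, hwh, hh⟩ := ih (mem_mul_mul_pow_succ (hB _ (mul_mem hb haB)) hwmem)
      exact ⟨h, (hconj.trans (isTwistedConj_mul_map_mul s w (b * a))).trans hwh, hh⟩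

theorem exists_isTwistedConj_of_sup_eq_top (hsup : A ⊔ B = ⊤) (hA : ∀ a ∈ A, s a ∈ A)
    (hB : ∀ b ∈ B, s b ∈ B) (g : G) :
    ∃ h, IsTwistedConj s g h ∧ (h ∈ A ∨ h ∈ B ∨ h ∈ alternatingSubsemigroup A B) := by
  obtain ⟨n, hn⟩ := exists_mem_mul_pow_of_sup_eq_top hsup g
  exact exists_isTwistedConj_of_mem_mul_pow hA hB hn

end TwistedConjugacy

section GrowthRate

open Filter Topology

/-- The exponential growth rate of the sequence `u` is `L`: the `r`-th roots of `u r` tend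
to `L`. -/
def HasGrowthRate (u : ℕ → ℕ) (L : ℝ) : Prop :=
  Tendsto (fun r : ℕ => (u r : ℝ) ^ (1 / (r : ℝ))) atTop (𝓝 L)

theorem tendsto_const_rpow_one_div {C : ℝ} (hC : 0 < C) :
    Tendsto (fun r : ℕ => C ^ (1 / (r : ℝ))) atTop (𝓝 1) := by
  have h := (Real.continuousAt_const_rpow (b := 0) hC.ne').tendsto.comp
    (tendsto_one_div_atTop_nhds_zero_nat (𝕜 := ℝ))
  rwa [Real.rpow_zero] at h

theorem rpow_one_div_natCast_lt_iff {x ρ : ℝ} {r : ℕ} (hx : 0 ≤ x) (hρ : 0 ≤ ρ) (hr : r ≠ 0) :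
    x ^ (1 / (r : ℝ)) < ρ ↔ x < ρ ^ r := by
  rw [one_div, Real.rpow_inv_lt_iff_of_pos hx hρ (by positivity), Real.rpow_natCast]

namespace HasGrowthRate

variable {u v : ℕ → ℕ} {L L' : ℝ}

theorem unique (hL : HasGrowthRate u L) (hL' : HasGrowthRate u L') : L = L' :=
  tendsto_nhds_unique hL hL'

theorem mono (huv : ∀ r, u r ≤ v r) (hu : HasGrowthRate u L) (hv : HasGrowthRate v L') : L ≤ L' :=
  le_of_tendsto_of_tendsto' hu hv fun r =>
    Real.rpow_le_rpow (Nat.cast_nonneg _) (Nat.cast_le.2 (huv r)) (by positivity)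

theorem nonneg (hu : HasGrowthRate u L) : 0 ≤ L :=
  ge_of_tendsto' hu fun _ => by positivity

theorem of_le_mul {C : ℕ} (hC : 0 < C) (huv : ∀ r, u r ≤ C * v r) (hvu : ∀ r, v r ≤ C * u r)
    (hu : HasGrowthRate u L) : HasGrowthRate v L := by
  have hC' : (0 : ℝ) < C := Nat.cast_pos.2 hC
  have hlower := (tendsto_const_rpow_one_div (inv_pos.2 hC')).mul hu
  have hupper := (tendsto_const_rpow_one_div hC').mul hu
  rw [one_mul] at hlower hupper
  refine tendsto_of_tendsto_of_tendsto_of_le_of_le hlower hupper (fun r => ?_) fun r => ?_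
  · dsimp only
    rw [← Real.mul_rpow (inv_pos.2 hC').le (Nat.cast_nonneg _)]
    refine Real.rpow_le_rpow (by positivity) ?_ (by positivity)
    rw [inv_mul_le_iff₀ hC']
    exact_mod_cast huv r
  · dsimp only
    rw [← Real.mul_rpow hC'.le (Nat.cast_nonneg _)]
    exact Real.rpow_le_rpow (by positivity) (by exact_mod_cast hvu r) (by positivity)

theorem natCast_of_eq_pow {D : ℕ} (hu : ∀ r ≠ 0, u r = D ^ r) : HasGrowthRate u D := by
  refine tendsto_const_nhds.congr' ?_
  filter_upwards [eventually_ne_atTop 0] with r hr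
  rw [hu r hr, Nat.cast_pow, one_div, Real.pow_rpow_inv_natCast (Nat.cast_nonneg D) hr]

theorem one_of_bounded {C : ℕ} (hpos : ∀ r, 0 < u r) (hC : ∀ r, u r ≤ C) : HasGrowthRate u 1 := by
  have hone : HasGrowthRate (fun _ => 1) 1 := by
    simpa only [Nat.cast_one] using natCast_of_eq_pow fun r _ => (one_pow r).symm
  have hC' : 0 < C := (hpos 0).trans_le (hC 0)
  exact hone.of_le_mul hC' (fun r => Nat.mul_pos hC' (hpos r))
    fun r => (hC r).trans (mul_one C).ge

end HasGrowthRate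

theorem exists_le_mul_pow_of_recursion {e G D : ℕ → ℕ} {s : ℕ} {ρ : ℝ} (hρ : 0 ≤ ρ)
    (hrec : ∀ s r, e (s + r) ≤ e s * G r + D s * e r)
    (hG : ∀ r, s ≤ r → (G r : ℝ) ≤ ρ ^ r) (hD : (D s : ℝ) < ρ ^ s) :
    ∃ B : ℝ, 0 < B ∧ ∀ j : ℕ, (e ((j + 1) * s) : ℝ) ≤ B * ρ ^ ((j + 1) * s) := by
  have hpos : 0 < ρ ^ s - D s := sub_pos.2 hD
  -- `B * ρ ^ r` is a supersolution of the recursion along the multiples of `s`.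
  set B : ℝ := (e s + 1) / (ρ ^ s - D s)
  have hB₀ : 0 < B := by positivity
  have hstep : e s + D s * B ≤ B * ρ ^ s := by
    have hBmul : B * (ρ ^ s - D s) = e s + 1 := div_mul_cancel₀ _ hpos.ne'
    linarith
  refine ⟨B, hB₀, fun j => ?_⟩
  induction j with
  | zero =>
    rw [zero_add, one_mul]
    have : (0 : ℝ) ≤ D s * B := by positivity
    linarith
  | succ j ih =>
    set r := (j + 1) * s with hr
    calc (e ((j + 1 + 1) * s) : ℝ) = e (s + r) := by rw [hr, add_one_mul (j + 1) s, add_comm]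
      _ ≤ e s * G r + D s * e r := by exact_mod_cast hrec s r
      _ ≤ e s * ρ ^ r + D s * (B * ρ ^ r) := by
        gcongr
        exact hG r (Nat.le_mul_of_pos_left s j.succ_pos)
      _ = (e s + D s * B) * ρ ^ r := by ring
      _ ≤ B * ρ ^ s * ρ ^ r := by gcongr
      _ = B * ρ ^ ((j + 1 + 1) * s) := by rw [mul_assoc, ← pow_add, add_one_mul (j + 1) s, add_comm]

theorem HasGrowthRate.le_of_le_mul_pow {u : ℕ → ℕ} {L B ρ : ℝ} {s : ℕ} (hu : HasGrowthRate u L)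
    (hs : s ≠ 0) (hB : 0 < B) (hρ : 0 ≤ ρ)
    (h : ∀ j : ℕ, (u ((j + 1) * s) : ℝ) ≤ B * ρ ^ ((j + 1) * s)) : L ≤ ρ := by
  have hsub : Tendsto (fun j : ℕ => (j + 1) * s) atTop atTop :=
    ((tendsto_add_atTop_nat 1).atTop_mul_const' (Nat.pos_of_ne_zero hs))
  have hlim := ((tendsto_const_rpow_one_div hB).mul_const ρ).comp hsub
  rw [one_mul] at hlim
  refine le_of_tendsto_of_tendsto' (hu.comp hsub) hlim fun j => ?_
  have hne : (j + 1) * s ≠ 0 := mul_ne_zero j.succ_ne_zero hs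
  dsimp only [Function.comp_apply]
  refine (Real.rpow_le_rpow (Nat.cast_nonneg _) (h j) (by positivity)).trans_eq ?_
  rw [Real.mul_rpow hB.le (by positivity), one_div, Real.pow_rpow_inv_natCast hρ hne]

theorem HasGrowthRate.eq_max {e G D : ℕ → ℕ} {eRate GRate DRate : ℝ} (hG : ∀ r, G r ≤ e r)
    (hD : ∀ r, D r ≤ e r) (hrec : ∀ s r, e (s + r) ≤ e s * G r + D s * e r)
    (heRate : HasGrowthRate e eRate) (hGRate : HasGrowthRate G GRate)
    (hDRate : HasGrowthRate D DRate) : eRate = max GRate DRate := by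
  refine le_antisymm (le_of_forall_gt_imp_ge_of_dense fun ρ hlt => ?_)
    (max_le (hGRate.mono hG heRate) (hDRate.mono hD heRate))
  obtain ⟨hGρ, hDρ⟩ := max_lt_iff.1 hlt
  have hρ : 0 ≤ ρ := hGRate.nonneg.trans hGρ.le
  have hev : ∀ᶠ r : ℕ in atTop, r ≠ 0 ∧ (G r : ℝ) < ρ ^ r ∧ (D r : ℝ) < ρ ^ r := by
    filter_upwards [eventually_ne_atTop 0, hGRate.eventually_lt_const hGρ,
      hDRate.eventually_lt_const hDρ] with r hr hGr hDr
    exact ⟨hr, (rpow_one_div_natCast_lt_iff (Nat.cast_nonneg _) hρ hr).1 hGr,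
      (rpow_one_div_natCast_lt_iff (Nat.cast_nonneg _) hρ hr).1 hDr⟩
  obtain ⟨s, hs⟩ := eventually_atTop.1 hev
  have hs₀ : s ≠ 0 := (hs s le_rfl).1
  obtain ⟨B, hB, hbound⟩ := exists_le_mul_pow_of_recursion hρ hrec
    (fun r hr => (hs r hr).2.1.le) (hs s le_rfl).2.2
  exact heRate.le_of_le_mul_pow hs₀ hB hρ hbound

end GrowthRate

section TwistedPowers

variable {M : Type*} [Monoid M] {s : M →* M} {h : M}

/-- The twisted powers `sʳ⁻¹(h) ⋯ s(h) h`. These are the iterates of a semilinear map with linear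
part `h`. -/
def twistedPow (s : M →* M) (h : M) : ℕ → M
  | 0 => 1
  | r + 1 => s (twistedPow s h r) * h

theorem twistedPow_one (s : M →* M) (h : M) : twistedPow s h 1 = h := by
  rw [twistedPow, twistedPow, map_one, one_mul]

theorem twistedPow_id (h : M) (r : ℕ) : twistedPow (MonoidHom.id M) h r = h ^ r := by
  induction r with
  | zero => exact (pow_zero h).symm
  | succ r ih => rw [twistedPow, ih, pow_succ, MonoidHom.id_apply]

theorem twistedPow_mem {S : Submonoid M} (hs : ∀ x ∈ S, s x ∈ S) (hh : h ∈ S) (r : ℕ) :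
    twistedPow s h r ∈ S := by
  induction r with
  | zero => exact S.one_mem
  | succ r ih => exact mul_mem (hs _ ih) hh

theorem twistedPow_conj {G : Type*} [Group G] (s : G →* G) (θ g : G) (r : ℕ) :
    twistedPow s (s θ * g * θ⁻¹) r = s^[r] θ * twistedPow s g r * θ⁻¹ := by
  induction r with
  | zero => rw [twistedPow, twistedPow, Function.iterate_zero_apply, mul_one, mul_inv_cancel]
  | succ r ih =>
    rw [twistedPow, ih, twistedPow, Function.iterate_succ_apply', map_mul, map_mul, map_inv]
    group

theorem map_twistedPow {N : Type*} [Monoid N] (f : M →* N) {t : N →* N}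
    (hst : ∀ x, f (s x) = t (f x)) (h : M) (r : ℕ) :
    f (twistedPow s h r) = twistedPow t (f h) r := by
  induction r with
  | zero => exact map_one f
  | succ r ih => rw [twistedPow, twistedPow, map_mul, hst, ih]

end TwistedPowers

namespace AffineEnd

open MvPolynomial

variable {K L : Type*} [Field K] [Field L] {n : ℕ}

/-- The action of a field homomorphism on the coefficients of an endomorphism. -/
noncomputable def mapCoeff (σ : K →+* L) : AffineEnd K n →* AffineEnd L n where
  toFun f := ⟨fun i => map σ (f.coord i)⟩
  map_one' := AffineEnd.ext (funext fun i => map_X σ i)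
  map_mul' f g := AffineEnd.ext (funext fun i => map_bind₁ σ g.coord (f.coord i))

theorem coord_mapCoeff (σ : K →+* L) (f : AffineEnd K n) (i : Fin n) :
    (mapCoeff σ f).coord i = map σ (f.coord i) := rfl

theorem mapCoeff_mapCoeff {M : Type*} [Field M] (σ : K →+* L) (τ : L →+* M) (f : AffineEnd K n) :
    mapCoeff τ (mapCoeff σ f) = mapCoeff (τ.comp σ) f :=
  AffineEnd.ext (funext fun _ => map_map _ _ _)

theorem mapCoeff_id : mapCoeff (RingHom.id K) = MonoidHom.id (AffineEnd K n) :=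
  MonoidHom.ext fun _ => AffineEnd.ext (funext fun _ => map_id _)

theorem totalDegree_coord_mapCoeff (σ : K →+* L) (f : AffineEnd K n) (i : Fin n) :
    ((mapCoeff σ f).coord i).totalDegree = (f.coord i).totalDegree := by
  rw [coord_mapCoeff, totalDegree, totalDegree, support_map_of_injective _ σ.injective]

theorem degree_mapCoeff (σ : K →+* L) (f : AffineEnd K n) : (mapCoeff σ f).degree = f.degree :=
  Finset.sup_congr rfl fun i _ => totalDegree_coord_mapCoeff σ f i

theorem IsTriangular.mapCoeff (σ : K →+* L) {d : ℕ} {f : AffineEnd K 2} (hf : IsTriangular d f) :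
    IsTriangular d (mapCoeff σ f) := by
  obtain ⟨a, b, c, Q, hQ, hf₀, hf₁⟩ := hf
  refine ⟨σ a, σ b, σ c, Q.map σ, Polynomial.natDegree_map_le.trans hQ, ?_, ?_⟩
  · rw [coord_mapCoeff, hf₀, map_add, map_mul, map_C, map_X, Polynomial.aeval_def,
      Polynomial.aeval_def, Polynomial.hom_eval₂, Polynomial.eval₂_map, map_X, algebraMap_eq,
      algebraMap_eq, map_comp_C]
  · rw [coord_mapCoeff, hf₁, map_add, map_mul, map_C, map_X, map_C]

end AffineEnd

section RestrictionToAxis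

open MvPolynomial

theorem totalDegree_aeval_le {σ τ R S : Type*} [CommSemiring R] [CommSemiring S] [Algebra R S]
    {F : σ → MvPolynomial τ S} {n : ℕ} (hF : ∀ i, (F i).totalDegree ≤ n) (p : MvPolynomial σ R) :
    (aeval F p).totalDegree ≤ p.totalDegree * n := by
  rw [aeval_def, eval₂_eq]
  refine totalDegree_finsetSum_le fun d hd => ?_
  calc (algebraMap R (MvPolynomial τ S) (p.coeff d) * ∏ i ∈ d.support, F i ^ d i).totalDegree
      ≤ (C (algebraMap R S (p.coeff d)) : MvPolynomial τ S).totalDegree +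
          ∑ i ∈ d.support, (F i ^ d i).totalDegree :=
        (totalDegree_mul _ _).trans (Nat.add_le_add_left (totalDegree_finsetProd _ _) _)
    _ = ∑ i ∈ d.support, (F i ^ d i).totalDegree := by rw [totalDegree_C, zero_add]
    _ ≤ ∑ i ∈ d.support, d i * n :=
        Finset.sum_le_sum fun i _ => (totalDegree_pow _ _).trans (Nat.mul_le_mul_left _ (hF i))
    _ = (d.sum fun _ e => e) * n := by rw [Finsupp.sum, Finset.sum_mul]
    _ ≤ p.totalDegree * n := Nat.mul_le_mul_right n (le_totalDegree hd)

variable {R : Type*} [CommSemiring R] {p : MvPolynomial (Fin 2) R} {D : ℕ}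

theorem coeff_aeval_pair_mul {E : ℕ} (hp : p.totalDegree ≤ D) {G₀ G₁ : Polynomial R}
    (hG₀ : G₀.natDegree ≤ E) (hG₁ : G₁.natDegree < E) :
    (aeval ![G₀, G₁] p).coeff (D * E) = p.coeff (Finsupp.single 0 D) * G₀.coeff E ^ D := by
  rw [aeval_def, eval₂_eq', Polynomial.finsetSum_coeff]
  simp only [Fin.prod_univ_two, Matrix.cons_val_zero, Matrix.cons_val_one,
    ← Polynomial.C_eq_algebraMap, Polynomial.coeff_C_mul]
  rw [Finset.sum_eq_single (Finsupp.single 0 D)]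
  · rw [Finsupp.single_eq_same, Finsupp.single_eq_of_ne one_ne_zero, pow_zero, mul_one, mul_comm D,
      ← Polynomial.coeff_pow_of_natDegree_le hG₀, mul_comm D]
  · intro d hd hne
    have hdeg : d 0 + d 1 ≤ D := by
      rw [← Fin.sum_univ_two (f := d), ← Finsupp.sum_fintype d (fun _ e => e) fun _ => rfl]
      exact (le_totalDegree hd).trans hp
    have hlt : d 0 * G₀.natDegree + d 1 * G₁.natDegree < D * E := by
      obtain h₁ | h₁ := (d 1).eq_zero_or_pos
      · have h₀ : d 0 < D := (Nat.le_of_add_right_le hdeg).lt_of_ne fun h₀ =>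
          hne (Finsupp.ext (Fin.forall_fin_two.2 ⟨by simpa using h₀, by simpa using h₁⟩))
        nlinarith
      · nlinarith
    rw [Polynomial.coeff_eq_zero_of_natDegree_lt, mul_zero]
    refine (Polynomial.natDegree_mul_le).trans_lt (lt_of_le_of_lt ?_ hlt)
    exact Nat.add_le_add Polynomial.natDegree_pow_le Polynomial.natDegree_pow_le
  · intro h
    rw [notMem_support_iff.1 h, zero_mul]

/-- The restriction `p(T, 0)` of a polynomial in two variables to the first axis. -/
noncomputable def restrictAxis : MvPolynomial (Fin 2) R →ₐ[R] Polynomial R :=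
  aeval ![Polynomial.X, 0]

theorem coeff_restrictAxis (hp : p.totalDegree ≤ D) :
    (restrictAxis p).coeff D = p.coeff (Finsupp.single 0 D) := by
  simpa only [restrictAxis, mul_one, Polynomial.coeff_X_one, one_pow] using
    coeff_aeval_pair_mul hp Polynomial.natDegree_X_le (Polynomial.natDegree_zero.trans_lt one_pos)

theorem natDegree_restrictAxis_le (p : MvPolynomial (Fin 2) R) :
    (restrictAxis p).natDegree ≤ p.totalDegree := by
  simpa only [mul_one, restrictAxis] using aeval_natDegree_le (n := 1) p le_rfl _
    (Fin.forall_fin_two.2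
      ⟨Polynomial.natDegree_X_le, Polynomial.natDegree_zero.trans_le zero_le_one⟩)

theorem eq_sum_C_mul_X_add_C_of_totalDegree_le_one {σ : Type*} [Fintype σ] {p : MvPolynomial σ R}
    (hp : p.totalDegree ≤ 1) :
    p = ∑ i, C (p.coeff (Finsupp.single i 1)) * X i + C (p.coeff 0) := by
  classical
  ext d
  simp only [coeff_add, coeff_sum, coeff_C_mul, coeff_X, coeff_C, mul_ite, mul_one, mul_zero]
  obtain rfl | hd₀ := eq_or_ne d 0
  · rw [if_pos rfl, Finset.sum_eq_zero, zero_add]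
    exact fun i _ => if_neg (Finsupp.single_ne_zero.2 one_ne_zero)
  rw [if_neg hd₀.symm, add_zero]
  obtain ⟨i, rfl⟩ | hd := em (∃ i, d = Finsupp.single i 1)
  · rw [Finset.sum_eq_single i, if_pos rfl]
    · exact fun j _ hj => if_neg fun h => hj (Finsupp.single_left_injective one_ne_zero h)
    · exact fun hi => absurd (Finset.mem_univ i) hi
  · rw [Finset.sum_eq_zero fun i _ => if_neg fun h => hd ⟨i, h.symm⟩]
    refine notMem_support_iff.1 fun hmem => hd ?_
    exact (Finsupp.sum_eq_one_iff d).1 (((le_totalDegree hmem).trans hp).antisymm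
      (Nat.one_le_iff_ne_zero.2 ((Finsupp.degree_eq_zero_iff d).not.2 hd₀)))

theorem coeff_aeval_of_totalDegree_le_one (hp : p.totalDegree ≤ 1) (Q : Polynomial R) :
    (Polynomial.aeval p Q).coeff (Finsupp.single 0 Q.natDegree) =
      Q.leadingCoeff * p.coeff (Finsupp.single 0 1) ^ Q.natDegree := by
  have hdeg : (Polynomial.aeval p Q).totalDegree ≤ Q.natDegree := by
    simpa only [mul_one] using
      (totalDegree_aeval_polynomial_le p Q).trans (Nat.mul_le_mul_left _ hp)
  have hq : (restrictAxis p).natDegree ≤ 1 := (natDegree_restrictAxis_le p).trans hp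
  have hlower {j : ℕ} (hj : j < Q.natDegree) : (restrictAxis p ^ j).coeff Q.natDegree = 0 := by
    refine Polynomial.coeff_eq_zero_of_natDegree_lt (lt_of_le_of_lt ?_ hj)
    simpa only [mul_one] using Polynomial.natDegree_pow_le_of_le j hq
  rw [← coeff_restrictAxis hdeg, ← Polynomial.aeval_algHom_apply, ← coeff_restrictAxis hp,
    Polynomial.aeval_eq_sum_range, Polynomial.finsetSum_coeff, Finset.sum_range_succ,
    Finset.sum_eq_zero fun j hj => ?_, zero_add, Polynomial.coeff_smul, smul_eq_mul,
    Polynomial.coeff_natDegree]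
  · congr 1
    simpa only [mul_one] using Polynomial.coeff_pow_of_natDegree_le (m := Q.natDegree) hq
  · rw [Polynomial.coeff_smul, hlower (Finset.mem_range.1 hj), smul_zero]

end RestrictionToAxis

namespace AffineEnd

open MvPolynomial

variable {K L : Type*} [Field K] [Field L]

/-- The endomorphism `f = (f₀, f₁)` of the plane has `deg f₁ < deg f₀ = D`, and `x ^ D` occurs in
`f₀`. Hence the degrees of such endomorphisms multiply under composition. -/
structure IsDominant (D : ℕ) (f : AffineEnd K 2) : Prop where
  totalDegree_coord_zero_le : (f.coord 0).totalDegree ≤ D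
  totalDegree_coord_one_lt : (f.coord 1).totalDegree < D
  coeff_ne_zero : (f.coord 0).coeff (Finsupp.single 0 D) ≠ 0

namespace IsDominant

variable {D E : ℕ} {f g : AffineEnd K 2}

theorem degree_eq (hf : IsDominant D f) : f.degree = D := by
  refine le_antisymm (degree_le_iff.2 (Fin.forall_fin_two.2
    ⟨hf.totalDegree_coord_zero_le, hf.totalDegree_coord_one_lt.le⟩)) ?_
  have h := (le_totalDegree (mem_support_iff.2 hf.coeff_ne_zero)).trans (totalDegree_coord_le f 0)
  rwa [Finsupp.sum_single_index rfl] at h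

theorem mul (hf : IsDominant D f) (hg : IsDominant E g) : IsDominant (D * E) (f * g) := by
  have hgdeg := degree_le_iff.1 hg.degree_eq.le
  have hE : 0 < E := (Nat.zero_le _).trans_lt hg.totalDegree_coord_one_lt
  have hdeg (i : Fin 2) : ((f * g).coord i).totalDegree ≤ (f.coord i).totalDegree * E :=
    totalDegree_aeval_le hgdeg _
  have hdeg₀ := (hdeg 0).trans (Nat.mul_le_mul_right E hf.totalDegree_coord_zero_le)
  refine ⟨hdeg₀, (hdeg 1).trans_lt (Nat.mul_lt_mul_of_pos_right hf.totalDegree_coord_one_lt hE), ?_⟩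
  have hrestrict : restrictAxis ((f * g).coord 0) =
      aeval ![restrictAxis (g.coord 0), restrictAxis (g.coord 1)] (f.coord 0) := by
    rw [coord_mul, bind₁, ← AlgHom.comp_apply, comp_aeval]
    congr 2
    funext i
    fin_cases i <;> rfl
  rw [← coeff_restrictAxis hdeg₀, hrestrict, coeff_aeval_pair_mul hf.totalDegree_coord_zero_le
      ((natDegree_restrictAxis_le _).trans hg.totalDegree_coord_zero_le)
      ((natDegree_restrictAxis_le _).trans_lt hg.totalDegree_coord_one_lt),
    coeff_restrictAxis hg.totalDegree_coord_zero_le]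
  exact mul_ne_zero hf.coeff_ne_zero (pow_ne_zero D hg.coeff_ne_zero)

theorem mapCoeff (σ : K →+* L) (hf : IsDominant D f) : IsDominant D (mapCoeff σ f) where
  totalDegree_coord_zero_le := (totalDegree_coord_mapCoeff σ f 0).trans_le hf.1
  totalDegree_coord_one_lt := (totalDegree_coord_mapCoeff σ f 1).trans_lt hf.2
  coeff_ne_zero := by
    rw [coord_mapCoeff, coeff_map]
    exact (map_ne_zero σ).2 hf.coeff_ne_zero

theorem twistedPow (σ : K →+* K) (hf : IsDominant D f) (r : ℕ) :
    IsDominant (D ^ (r + 1)) (twistedPow (AffineEnd.mapCoeff σ) f (r + 1)) := by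
  induction r with
  | zero => rwa [zero_add, pow_one, twistedPow_one]
  | succ r ih =>
    rw [pow_succ]
    exact (ih.mapCoeff σ).mul hf

end IsDominant

theorem coeff_coord_one_ne_zero_of_notMem_triangularSubmonoid {φ : (AffineEnd K 2)ˣ}
    (hφ : φ ∈ affineSubmonoid K 2) (hφ' : φ ∉ triangularSubmonoid K) :
    (φ.1.coord 1).coeff (Finsupp.single 0 1) ≠ 0 := by
  have hlinear (i : Fin 2) :=
    eq_sum_C_mul_X_add_C_of_totalDegree_le_one (degree_le_iff.1 hφ i)
  simp only [Fin.sum_univ_two] at hlinear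
  refine fun h => hφ' ⟨1, (φ.1.coord 0).coeff (Finsupp.single 0 1),
    (φ.1.coord 1).coeff (Finsupp.single 1 1), (φ.1.coord 1).coeff 0,
    Polynomial.C ((φ.1.coord 0).coeff (Finsupp.single 1 1)) *
    Polynomial.X + Polynomial.C ((φ.1.coord 0).coeff 0), Polynomial.natDegree_linear_le,
    (hlinear 0).trans ?_, (hlinear 1).trans ?_⟩
  · simp only [map_add, map_mul, Polynomial.aeval_C, Polynomial.aeval_X, algebraMap_eq, add_assoc]
  · rw [h, C_0, zero_mul, zero_add]

theorem exists_isDominant_mul {ψ φ : (AffineEnd K 2)ˣ} (hψ : ψ ∈ triangularSubmonoid K)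
    (hψ' : ψ ∉ affineSubmonoid K 2) (hφ : φ ∈ affineSubmonoid K 2)
    (hφ' : φ ∉ triangularSubmonoid K) : ∃ D, IsDominant D (ψ * φ).1 := by
  obtain ⟨-, a, b, c, Q, -, hψ₀, hψ₁⟩ := hψ
  have hψdeg : ψ.1.degree ≤ max Q.natDegree 1 :=
    IsTriangular.degree_le ⟨a, b, c, Q, le_rfl, hψ₀, hψ₁⟩
  have hQ : 1 < Q.natDegree :=
    (lt_max_iff.1 ((not_le.1 hψ').trans_le hψdeg)).resolve_right (lt_irrefl 1)
  have hφdeg := degree_le_iff.1 hφ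
  have hcoord₀ : (ψ * φ).1.coord 0 = C a * φ.1.coord 0 + Polynomial.aeval (φ.1.coord 1) Q := by
    rw [Units.val_mul, coord_mul, hψ₀, map_add, map_mul, bind₁_C_right, bind₁_X_right,
      ← Polynomial.aeval_algHom_apply, bind₁_X_right]
  have hcoord₁ : (ψ * φ).1.coord 1 = C b * φ.1.coord 1 + C c := by
    rw [Units.val_mul, coord_mul, hψ₁, map_add, map_mul, bind₁_C_right, bind₁_C_right,
      bind₁_X_right]
  have hdeg₀ : ((ψ * φ).1.coord 0).totalDegree ≤ Q.natDegree := by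
    refine (totalDegree_coord_le _ 0).trans ((degree_mul_le ψ.1 φ.1).trans ?_)
    simpa only [mul_one, max_eq_left hQ.le] using Nat.mul_le_mul hψdeg hφ
  have hdeg₁ : ((ψ * φ).1.coord 1).totalDegree ≤ 1 := by
    rw [hcoord₁]
    refine (totalDegree_add _ _).trans (max_le ((totalDegree_mul _ _).trans ?_) ?_)
    · rw [totalDegree_C, zero_add]
      exact hφdeg 1
    · exact (totalDegree_C c).trans_le zero_le_one
  refine ⟨Q.natDegree, hdeg₀, hdeg₁.trans_lt hQ, ?_⟩
  have hlower : (φ.1.coord 0).coeff (Finsupp.single 0 Q.natDegree) = 0 := by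
    refine coeff_eq_zero_of_totalDegree_lt ((hφdeg 0).trans_lt ?_)
    rwa [← Finsupp.degree_apply, Finsupp.degree_single]
  rw [hcoord₀, coeff_add, coeff_C_mul, hlower, mul_zero, zero_add,
    coeff_aeval_of_totalDegree_le_one (hφdeg 1)]
  exact mul_ne_zero (Polynomial.leadingCoeff_ne_zero.2 (Polynomial.ne_zero_of_natDegree_gt hQ))
    (pow_ne_zero _ (coeff_coord_one_ne_zero_of_notMem_triangularSubmonoid hφ hφ'))

theorem exists_isDominant_of_mem_alternatingSubsemigroup {φ : (AffineEnd K 2)ˣ}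
    (hφ : φ ∈ alternatingSubsemigroup (affineSubmonoid K 2) (triangularSubmonoid K)) :
    ∃ D, IsDominant D φ.1 := by
  induction hφ using Subsemigroup.closure_induction with
  | mem _ hg =>
    obtain ⟨b, a, hb, hb', ha, ha', rfl⟩ := hg
    exact exists_isDominant_mul hb hb' ha ha'
  | mul _ _ _ _ hφ hψ =>
    obtain ⟨D, hD⟩ := hφ
    obtain ⟨E, hE⟩ := hψ
    exact ⟨D * E, hD.mul hE⟩

end AffineEnd

namespace AffineEnd

variable {K : Type*} [Field K] {n : ℕ} {σ : K →+* K} {L : ℝ}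

theorem hasGrowthRate_degree_pow (f : AffineEnd K n) :
    HasGrowthRate (fun r => (f ^ r).degree) f.dynamicalDegree :=
  tendsto_dynamicalDegree f

theorem degree_iterate_map_mapCoeff (φ : (AffineEnd K n)ˣ) (r : ℕ) :
    ((Units.map (mapCoeff σ))^[r] φ).1.degree = φ.1.degree := by
  induction r with
  | zero => rfl
  | succ r ih =>
    rw [Function.iterate_succ_apply', ← ih]
    exact degree_mapCoeff σ _

theorem degree_twistedPow_conj_le (θ g : (AffineEnd K n)ˣ) (r : ℕ) :
    (twistedPow (Units.map (mapCoeff σ)) (Units.map (mapCoeff σ) θ * g * θ⁻¹) r).1.degree ≤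
      θ.1.degree * (θ⁻¹).1.degree * (twistedPow (Units.map (mapCoeff σ)) g r).1.degree := by
  rw [twistedPow_conj]
  refine (degree_mul_le _ _).trans ((Nat.mul_le_mul_right _ (degree_mul_le _ _)).trans_eq ?_)
  rw [degree_iterate_map_mapCoeff, mul_right_comm]

theorem hasGrowthRate_twistedPow_of_isTwistedConj {g h : (AffineEnd K (n + 1))ˣ}
    (hgh : IsTwistedConj (Units.map (mapCoeff σ)) g h)
    (hh : HasGrowthRate (fun r => (twistedPow (Units.map (mapCoeff σ)) h r).1.degree) L) :
    HasGrowthRate (fun r => (twistedPow (Units.map (mapCoeff σ)) g r).1.degree) L := by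
  obtain ⟨θ, rfl⟩ := hgh
  refine hh.of_le_mul (Nat.mul_pos (degree_pos θ) (degree_pos θ⁻¹))
    (degree_twistedPow_conj_le θ g) fun r => ?_
  have h := degree_twistedPow_conj_le (σ := σ) θ⁻¹ (Units.map (mapCoeff σ) θ * g * θ⁻¹) r
  have hg : Units.map (mapCoeff σ) θ⁻¹ * (Units.map (mapCoeff σ) θ * g * θ⁻¹) * θ⁻¹⁻¹ = g := by
    rw [map_inv]
    group
  rwa [hg, inv_inv, mul_comm (θ⁻¹).1.degree] at h

theorem hasGrowthRate_twistedPow_of_isDominant {D : ℕ} {f : AffineEnd K 2} (hf : IsDominant D f) :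
    HasGrowthRate (fun r => (twistedPow (mapCoeff σ) f r).degree) D := by
  refine .natCast_of_eq_pow fun r hr => ?_
  obtain ⟨r, rfl⟩ := Nat.exists_eq_succ_of_ne_zero hr
  exact (hf.twistedPow σ r).degree_eq

theorem map_mapCoeff_mem_affineSubmonoid {φ : (AffineEnd K n)ˣ} (hφ : φ ∈ affineSubmonoid K n) :
    Units.map (mapCoeff σ) φ ∈ affineSubmonoid K n :=
  (degree_mapCoeff σ φ.1).trans_le hφ

theorem map_mapCoeff_mem_triangularSubmonoid {φ : (AffineEnd K 2)ˣ}
    (hφ : φ ∈ triangularSubmonoid K) : Units.map (mapCoeff σ) φ ∈ triangularSubmonoid K := by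
  obtain ⟨d, hd⟩ := hφ
  exact ⟨d, hd.mapCoeff σ⟩

theorem hasGrowthRate_twistedPow_of_mem_affineSubmonoid {φ : (AffineEnd K (n + 1))ˣ}
    (hφ : φ ∈ affineSubmonoid K (n + 1)) :
    HasGrowthRate (fun r => (twistedPow (Units.map (mapCoeff σ)) φ r).1.degree) 1 :=
  .one_of_bounded (fun _ => degree_pos _) fun r =>
    twistedPow_mem (S := affineSubmonoid K (n + 1))
      (fun _ hx => map_mapCoeff_mem_affineSubmonoid hx) hφ r

theorem hasGrowthRate_twistedPow_of_mem_triangularSubmonoid {φ : (AffineEnd K 2)ˣ}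
    (hφ : φ ∈ triangularSubmonoid K) :
    HasGrowthRate (fun r => (twistedPow (Units.map (mapCoeff σ)) φ r).1.degree) 1 := by
  obtain ⟨d, hd⟩ := hφ
  refine .one_of_bounded (C := max d 1) (fun _ => degree_pos _) fun r => IsTriangular.degree_le ?_
  induction r with
  | zero => exact isTriangular_one.mono (Nat.zero_le d)
  | succ r ih => exact (ih.mapCoeff σ).mul hd

theorem val_twistedPow (φ : (AffineEnd K n)ˣ) (r : ℕ) :
    (twistedPow (Units.map (mapCoeff σ)) φ r).1 = twistedPow (mapCoeff σ) φ.1 r :=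
  map_twistedPow (Units.coeHom _) (fun _ => rfl) φ r

theorem exists_hasGrowthRate_twistedPow (σ : K →+* K) (φ : (AffineEnd K 2)ˣ) :
    ∃ d : ℕ, HasGrowthRate (fun r => (twistedPow (mapCoeff σ) φ.1 r).degree) d := by
  obtain ⟨θ, hθ, hcases⟩ := exists_isTwistedConj_of_sup_eq_top
    affineSubmonoid_sup_triangularSubmonoid
    (fun _ hφ => map_mapCoeff_mem_affineSubmonoid (σ := σ) hφ)
    (fun _ hφ => map_mapCoeff_mem_triangularSubmonoid hφ) φ
  suffices ∃ d : ℕ,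
      HasGrowthRate (fun r => (twistedPow (Units.map (mapCoeff σ)) θ r).1.degree) d by
    obtain ⟨d, hd⟩ := this
    exact ⟨d, by
      simpa only [val_twistedPow] using hasGrowthRate_twistedPow_of_isTwistedConj hθ hd⟩
  obtain hθ | hθ | hθ := hcases
  · exact ⟨1, Nat.cast_one (R := ℝ) ▸ hasGrowthRate_twistedPow_of_mem_affineSubmonoid hθ⟩
  · exact ⟨1, Nat.cast_one (R := ℝ) ▸ hasGrowthRate_twistedPow_of_mem_triangularSubmonoid hθ⟩
  · obtain ⟨D, hD⟩ := exists_isDominant_of_mem_alternatingSubsemigroup hθ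
    exact ⟨D, by simpa only [val_twistedPow] using hasGrowthRate_twistedPow_of_isDominant hD⟩

end AffineEnd

section SplitVars

open MvPolynomial

variable {R : Type*} [CommSemiring R] {m c : ℕ}

variable (R m c) in
/-- The isomorphism `R[x₁, …, x_{m+c}] ≃ R[x₁, …, x_m][x_{m+1}, …, x_{m+c}]`, through which an
endomorphism fibred over `𝔸ᵐ` is seen as a family of endomorphisms of `𝔸ᶜ`. -/
noncomputable def splitVars :
    MvPolynomial (Fin (m + c)) R ≃ₐ[R] MvPolynomial (Fin c) (MvPolynomial (Fin m) R) :=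
  (renameEquiv R (finSumFinEquiv.symm.trans (Equiv.sumComm _ _))).trans
    (sumAlgEquiv R (Fin c) (Fin m))

theorem splitVars_X_castAdd (i : Fin m) : splitVars R m c (X (Fin.castAdd c i)) = C (X i) := by
  simp [splitVars]

theorem splitVars_X_natAdd (j : Fin c) : splitVars R m c (X (Fin.natAdd m j)) = X j := by
  simp [splitVars]

theorem splitVars_C (a : R) : splitVars R m c (C a) = C (C a) := by
  simp [splitVars]

theorem splitVars_rename (p : MvPolynomial (Fin m) R) :
    splitVars R m c (rename (Fin.castAdd c) p) = C p := by
  induction p using MvPolynomial.induction_on with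
  | C a => rw [rename_C, splitVars_C]
  | add p q hp hq => rw [map_add, map_add, hp, hq, C_add]
  | mul_X p i hp => rw [map_mul, map_mul, hp, rename_X, splitVars_X_castAdd, C_mul]

theorem splitVars_monomial (d : Fin (m + c) →₀ ℕ) (a : R) :
    splitVars R m c (monomial d a) =
      monomial (d.comapDomain (Fin.natAdd m) (Fin.natAdd_injective c m).injOn)
        (monomial (d.comapDomain (Fin.castAdd c) (Fin.castAdd_injective m c).injOn) a) := by
  simp [monomial_eq, Finsupp.prod_fintype, Fin.prod_univ_add, splitVars_C, splitVars_X_castAdd,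
    splitVars_X_natAdd, mul_assoc]

theorem coeff_coeff_splitVars (p : MvPolynomial (Fin (m + c)) R) (d : Fin (m + c) →₀ ℕ) :
    ((splitVars R m c p).coeff
        (d.comapDomain (Fin.natAdd m) (Fin.natAdd_injective c m).injOn)).coeff
      (d.comapDomain (Fin.castAdd c) (Fin.castAdd_injective m c).injOn) = p.coeff d := by
  classical
  induction p using MvPolynomial.induction_on' with
  | monomial e a =>
    have hext : e = d ↔
        e.comapDomain (Fin.natAdd m) (Fin.natAdd_injective c m).injOn =
          d.comapDomain (Fin.natAdd m) (Fin.natAdd_injective c m).injOn ∧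
        e.comapDomain (Fin.castAdd c) (Fin.castAdd_injective m c).injOn =
          d.comapDomain (Fin.castAdd c) (Fin.castAdd_injective m c).injOn := by
      simp only [Finsupp.ext_iff, Finsupp.comapDomain_apply, Fin.forall_fin_add]
      exact and_comm
    rw [splitVars_monomial, coeff_monomial, coeff_monomial, apply_ite (coeff _),
      coeff_monomial, coeff_zero, ← ite_and]
    exact if_congr hext.symm rfl rfl
  | add p q hp hq => rw [map_add, coeff_add, coeff_add, coeff_add, hp, hq]

theorem sum_natAdd_le_totalDegree_splitVars {p : MvPolynomial (Fin (m + c)) R}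
    {d : Fin (m + c) →₀ ℕ} (hd : d ∈ p.support) :
    ∑ j, d (Fin.natAdd m j) ≤ (splitVars R m c p).totalDegree := by
  have hmem : d.comapDomain (Fin.natAdd m) (Fin.natAdd_injective c m).injOn ∈
      (splitVars R m c p).support :=
    mem_support_iff.2 fun h0 => mem_support_iff.1 hd <| by
      rw [← coeff_coeff_splitVars, h0, coeff_zero]
  simpa [Finsupp.sum_fintype] using le_totalDegree hmem

theorem totalDegree_splitVars_le (p : MvPolynomial (Fin (m + c)) R) :
    (splitVars R m c p).totalDegree ≤ p.totalDegree := by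
  have haeval : (splitVars R m c).toAlgHom = aeval (Fin.append (fun i => C (X i)) X) :=
    algHom_ext fun i => by
      induction i using Fin.addCases <;> simp [splitVars_X_castAdd, splitVars_X_natAdd]
  have hdegree : ∀ i, (Fin.append (fun i => C (X i)) X i :
      MvPolynomial (Fin c) (MvPolynomial (Fin m) R)).totalDegree ≤ 1 := fun i => by
    induction i using Fin.addCases with
    | left i => simp
    | right j => rw [Fin.append_right]; exact (totalDegree_monomial_le _ _).trans (by simp)
  have h := totalDegree_aeval_le hdegree p
  rwa [← haeval, mul_one] at h

theorem totalDegree_bind₁_le_of_splitVars {τ : Type*} {F : Fin (m + c) → MvPolynomial τ R} {a b : ℕ}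
    (hbase : ∀ i, (F (Fin.castAdd c i)).totalDegree ≤ a)
    (hfibre : ∀ j, (F (Fin.natAdd m j)).totalDegree ≤ b) (p : MvPolynomial (Fin (m + c)) R) :
    (bind₁ F p).totalDegree ≤ p.totalDegree * a + (splitVars R m c p).totalDegree * b := by
  rw [bind₁, aeval_def, eval₂_eq']
  refine totalDegree_finsetSum_le fun d hd => ?_
  have hbaseDegree : ∑ i, d (Fin.castAdd c i) ≤ p.totalDegree := by
    refine le_trans ?_ (le_totalDegree hd)
    rw [Finsupp.sum_fintype _ _ fun _ => rfl, Fin.sum_univ_add]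
    exact Nat.le_add_right _ _
  calc (algebraMap R (MvPolynomial τ R) (p.coeff d) * ∏ i, F i ^ d i).totalDegree
      ≤ ∑ i, (F i ^ d i).totalDegree := by
        refine (totalDegree_mul _ _).trans ?_
        rw [algebraMap_eq, totalDegree_C, zero_add]
        exact totalDegree_finsetProd _ _
    _ ≤ ∑ i, d i * (F i).totalDegree := Finset.sum_le_sum fun i _ => totalDegree_pow _ _
    _ ≤ ∑ i, d (Fin.castAdd c i) * a + ∑ j, d (Fin.natAdd m j) * b := by
        rw [Fin.sum_univ_add]
        gcongr with i _ j _
        exacts [hbase i, hfibre j]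
    _ ≤ p.totalDegree * a + (splitVars R m c p).totalDegree * b := by
        rw [← Finset.sum_mul, ← Finset.sum_mul]
        gcongr
        exact sum_natAdd_le_totalDegree_splitVars hd

end SplitVars

namespace AffineEnd

open MvPolynomial

variable {K : Type*} [Field K] {m c : ℕ} {f f' : AffineEnd K (m + c)} {g g' : AffineEnd K m}

/-- `f` maps the fibres of the projection `𝔸ᵐ⁺ᶜ → 𝔸ᵐ` to the first `m` coordinates to fibres, and
`g` is the endomorphism of the base induced by `f`. -/
def IsSkewOver (f : AffineEnd K (m + c)) (g : AffineEnd K m) : Prop :=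
  ∀ i, f.coord (Fin.castAdd c i) = rename (Fin.castAdd c) (g.coord i)

namespace IsSkewOver

theorem bind₁_rename (hf : IsSkewOver f g) (p : MvPolynomial (Fin m) K) :
    bind₁ f.coord (rename (Fin.castAdd c) p) = rename (Fin.castAdd c) (bind₁ g.coord p) := by
  rw [MvPolynomial.bind₁_rename, rename_bind₁]
  exact congrArg (bind₁ · p) (funext hf)

protected theorem mul (hf : IsSkewOver f g) (hf' : IsSkewOver f' g') :
    IsSkewOver (f * f') (g * g') := fun i => by
  rw [coord_mul, hf i, hf'.bind₁_rename, coord_mul]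

protected theorem one : IsSkewOver (1 : AffineEnd K (m + c)) (1 : AffineEnd K m) := fun i => by
  rw [coord_one, coord_one, rename_X]

protected theorem pow (hf : IsSkewOver f g) (r : ℕ) : IsSkewOver (f ^ r) (g ^ r) := by
  induction r with
  | zero => exact .one
  | succ r ih => rw [pow_succ, pow_succ]; exact ih.mul hf

theorem unique (hf : IsSkewOver f g) (hf' : IsSkewOver f g') : g = g' :=
  AffineEnd.ext <| funext fun i =>
    rename_injective _ (Fin.castAdd_injective m c) ((hf i).symm.trans (hf' i))

protected theorem inv {f : (AffineEnd K (m + c))ˣ} {g : (AffineEnd K m)ˣ}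
    (hf : IsSkewOver f.1 g.1) : IsSkewOver (f⁻¹).1 (g⁻¹).1 := fun i => by
  have h := congrArg (bind₁ (f⁻¹).1.coord) (hf.bind₁_rename ((g⁻¹).1.coord i))
  simpa only [bind₁_bind₁, bind₁_coord_inv, bind₁_inv_coord, rename_X, bind₁_X_left, bind₁_X_right,
    AlgHom.id_apply] using h.symm

theorem totalDegree_coord_castAdd (hf : IsSkewOver f g) (i : Fin m) :
    (f.coord (Fin.castAdd c i)).totalDegree = (g.coord i).totalDegree := by
  rw [hf i]
  refine le_antisymm (totalDegree_rename_le _ _) ?_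
  have hdegree (j : Fin (m + c)) : (Fin.append X 0 j : MvPolynomial (Fin m) K).totalDegree ≤ 1 := by
    induction j using Fin.addCases <;> simp
  have h := totalDegree_aeval_le hdegree (rename (Fin.castAdd c) (g.coord i))
  have hleft : Fin.append X 0 ∘ Fin.castAdd c = (X : Fin m → MvPolynomial (Fin m) K) :=
    funext fun j => Fin.append_left _ _ j
  rwa [aeval_rename, hleft, aeval_X_left_apply, mul_one] at h

theorem degree_le (hf : IsSkewOver f g) : g.degree ≤ f.degree :=
  degree_le_iff.2 fun i => hf.totalDegree_coord_castAdd i ▸ totalDegree_coord_le f _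

end IsSkewOver

variable (K m) in
/-- The function field of the base `𝔸ᵐ`. -/
abbrev BaseField : Type _ := FractionRing (MvPolynomial (Fin m) K)

/-- The last `c` coordinates of `f`, seen as an endomorphism of `𝔸ᶜ` over the function field of the
base `𝔸ᵐ`. For `f` that maps fibres to fibres this is its restriction to the generic fibre. -/
noncomputable def genericFibre (f : AffineEnd K (m + c)) : AffineEnd (BaseField K m) c :=
  ⟨fun j => map (algebraMap _ _) (splitVars K m c (f.coord (Fin.natAdd m j)))⟩

theorem coord_genericFibre (f : AffineEnd K (m + c)) (j : Fin c) :
    (genericFibre f).coord j =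
      map (algebraMap _ (BaseField K m)) (splitVars K m c (f.coord (Fin.natAdd m j))) := rfl

theorem totalDegree_coord_genericFibre (f : AffineEnd K (m + c)) (j : Fin c) :
    ((genericFibre f).coord j).totalDegree =
      (splitVars K m c (f.coord (Fin.natAdd m j))).totalDegree := by
  rw [coord_genericFibre, totalDegree, totalDegree,
    support_map_of_injective _ (IsFractionRing.injective _ _)]

theorem degree_genericFibre_le (f : AffineEnd K (m + c)) : (genericFibre f).degree ≤ f.degree :=
  degree_le_iff.2 fun j => (totalDegree_coord_genericFibre f j).trans_le <|
    (totalDegree_splitVars_le _).trans (totalDegree_coord_le f _)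

theorem totalDegree_coord_mul_le (f : AffineEnd K (m + c)) (hf' : IsSkewOver f' g')
    (i : Fin (m + c)) : ((f * f').coord i).totalDegree ≤
      f.degree * g'.degree + (splitVars K m c (f.coord i)).totalDegree * f'.degree := by
  rw [coord_mul]
  refine (totalDegree_bind₁_le_of_splitVars (a := g'.degree) (b := f'.degree)
    (fun i => ?_) (fun j => totalDegree_coord_le f' _) _).trans ?_
  · rw [hf'.totalDegree_coord_castAdd]
    exact totalDegree_coord_le g' i
  · gcongr
    exact totalDegree_coord_le f i

theorem IsSkewOver.degree_mul_le (hf : IsSkewOver f g) (hf' : IsSkewOver f' g') :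
    (f * f').degree ≤ f.degree * g'.degree + (genericFibre f).degree * f'.degree := by
  refine degree_le_iff.2 fun i => (totalDegree_coord_mul_le f hf' i).trans ?_
  gcongr
  induction i using Fin.addCases with
  | left i => rw [hf i, splitVars_rename, totalDegree_C]; exact Nat.zero_le _
  | right j => exact totalDegree_coord_genericFibre f j ▸ totalDegree_coord_le _ j

/-- The action of an automorphism of the base `𝔸ᵐ` on its function field, by composition. -/
noncomputable def pullback (g : (AffineEnd K m)ˣ) : BaseField K m →+* BaseField K m :=
  IsFractionRing.lift (g := (algebraMap _ (BaseField K m)).comp (bind₁ g.1.coord).toRingHom) <|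
    (IsFractionRing.injective _ _).comp <|
      Function.LeftInverse.injective (g := bind₁ (g⁻¹).1.coord) fun p => by
        simp [bind₁_bind₁, bind₁_inv_coord]

theorem pullback_algebraMap (g : (AffineEnd K m)ˣ) (p : MvPolynomial (Fin m) K) :
    pullback g (algebraMap _ _ p) = algebraMap _ _ (bind₁ g.1.coord p) :=
  IsFractionRing.lift_algebraMap _ _

theorem pullback_comp_pullback (g h : (AffineEnd K m)ˣ) :
    (pullback h).comp (pullback g) = pullback (g * h) := by
  refine IsFractionRing.ringHom_ext (A := MvPolynomial (Fin m) K) fun p => ?_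
  rw [RingHom.comp_apply, pullback_algebraMap, pullback_algebraMap, pullback_algebraMap,
    bind₁_bind₁]
  rfl

theorem pullback_one : pullback (1 : (AffineEnd K m)ˣ) = RingHom.id _ := by
  refine IsFractionRing.ringHom_ext (A := MvPolynomial (Fin m) K) fun p => ?_
  rw [pullback_algebraMap]
  exact congrArg _ (AlgHom.congr_fun bind₁_X_left p)

theorem map_splitVars_bind₁ {f : AffineEnd K (m + c)} {g : (AffineEnd K m)ˣ}
    (hf : IsSkewOver f g.1) (p : MvPolynomial (Fin (m + c)) K) :
    map (algebraMap _ (BaseField K m)) (splitVars K m c (bind₁ f.coord p)) =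
      bind₁ (genericFibre f).coord
        (map (pullback g) (map (algebraMap _ (BaseField K m)) (splitVars K m c p))) := by
  induction p using MvPolynomial.induction_on with
  | C a =>
    rw [bind₁_C_right, splitVars_C, map_C, map_C, bind₁_C_right, pullback_algebraMap, bind₁_C_right]
  | add p q hp hq => simp only [map_add, hp, hq]
  | mul_X p i hp =>
    simp only [map_mul, hp, bind₁_X_right]
    congr 1
    induction i using Fin.addCases with
    | left i =>
      rw [hf, splitVars_rename, splitVars_X_castAdd, map_C, map_C, map_C, bind₁_C_right,
        pullback_algebraMap, bind₁_X_right]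
    | right j => rw [splitVars_X_natAdd, map_X, map_X, bind₁_X_right, coord_genericFibre]

theorem genericFibre_mul (f : AffineEnd K (m + c)) {g' : (AffineEnd K m)ˣ}
    (hf' : IsSkewOver f' g'.1) :
    genericFibre (f * f') = mapCoeff (pullback g') (genericFibre f) * genericFibre f' :=
  AffineEnd.ext <| funext fun _ => map_splitVars_bind₁ hf' _

theorem genericFibre_one : genericFibre (1 : AffineEnd K (m + c)) = 1 :=
  AffineEnd.ext <| funext fun j => by
    rw [coord_genericFibre, coord_one, splitVars_X_natAdd, map_X, coord_one]

theorem genericFibre_pow {g : (AffineEnd K m)ˣ} (hf : IsSkewOver f g.1) (r : ℕ) :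
    genericFibre (f ^ r) = twistedPow (mapCoeff (pullback g)) (genericFibre f) r := by
  induction r with
  | zero => exact genericFibre_one
  | succ r ih => rw [pow_succ, genericFibre_mul _ hf, ih, twistedPow]

theorem isUnit_genericFibre {f : (AffineEnd K (m + c))ˣ} {g : (AffineEnd K m)ˣ}
    (hf : IsSkewOver f.1 g.1) : IsUnit (genericFibre f.1) := by
  have hleft := genericFibre_mul (f⁻¹).1 hf
  rw [Units.inv_mul, genericFibre_one] at hleft
  have hright := congrArg (mapCoeff (pullback g)) (genericFibre_mul f.1 hf.inv)
  rw [Units.mul_inv, genericFibre_one, map_one, map_mul, mapCoeff_mapCoeff, pullback_comp_pullback,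
    inv_mul_cancel, pullback_one, mapCoeff_id, MonoidHom.id_apply] at hright
  exact ⟨⟨_, _, hright.symm, hleft.symm⟩, rfl⟩

end AffineEnd

section DimensionOne

open MvPolynomial

theorem exists_eq_monomial_of_isWeightedHomogeneous {σ R : Type*} [Unique σ] [CommSemiring R]
    {w : σ → ℕ} {p : MvPolynomial σ R} {n : ℕ} (hw : w default ≠ 0)
    (hp : IsWeightedHomogeneous w p n) : ∃ d a, p = monomial d a := by
  classical
  obtain rfl | ⟨d, hd⟩ := (Finset.eq_empty_or_nonempty p.support).imp_left support_eq_empty.1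
  · exact ⟨0, 0, monomial_zero.symm⟩
  refine ⟨d, p.coeff d, MvPolynomial.ext _ _ fun e => ?_⟩
  rw [coeff_monomial]
  split_ifs with hde
  · rw [hde]
  · by_contra he
    have hweight := (hp he).trans (hp (mem_support_iff.1 hd)).symm
    rw [Finsupp.weight_apply, Finsupp.weight_apply, Finsupp.sum_fintype _ _ (by simp),
      Finsupp.sum_fintype _ _ (by simp), Fintype.sum_unique, Fintype.sum_unique] at hweight
    exact hde (Finsupp.unique_ext (Nat.eq_of_mul_eq_mul_right (Nat.pos_of_ne_zero hw) hweight.symm))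

theorem AffineEnd.degree_le_one_of_dim_one {K : Type*} [Field K] (φ : (AffineEnd K 1)ˣ) :
    φ.1.degree ≤ 1 := by
  by_contra! hφ
  obtain ⟨i, N, P, hP, hP₀, hrelation⟩ := exists_topForm_relation φ hφ
  obtain ⟨d, a, rfl⟩ := exists_eq_monomial_of_isWeightedHomogeneous
    (totalDegree_coord_pos φ default).ne' hP.isWeightedHomogeneous
  rw [bind₁_monomial, mul_eq_zero, Finset.prod_eq_zero_iff, C_eq_zero] at hrelation
  obtain ha | ⟨j, -, hj⟩ := hrelation
  · exact hP₀ (by rw [ha, monomial_zero])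
  · exact topForm_ne_zero (totalDegree_coord_pos φ j) (eq_zero_of_pow_eq_zero hj)

end DimensionOne

namespace AffineEnd

variable {K : Type*} [Field K] {m c n : ℕ}

variable (K n) in
/-- All automorphisms of `𝔸ⁿ` over `K` have an integral degree growth, also if an endomorphism of
`K` is applied to the coefficients before each composition. These twisted iterates occur as the
generic fibres of the iterates of an automorphism that is fibred in `𝔸ⁿ`. -/
def HasIntegralGrowth : Prop :=
  ∀ (σ : K →+* K) (φ : (AffineEnd K n)ˣ),
    ∃ d : ℕ, HasGrowthRate (fun r => (twistedPow (mapCoeff σ) φ.1 r).degree) d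

theorem HasIntegralGrowth.exists_dynamicalDegree_eq_intCast (h : HasIntegralGrowth K n)
    (φ : (AffineEnd K n)ˣ) : ∃ d : ℤ, φ.1.dynamicalDegree = d := by
  obtain ⟨d, hd⟩ := h (RingHom.id K) φ
  simp only [mapCoeff_id, twistedPow_id] at hd
  exact ⟨d, (hasGrowthRate_degree_pow φ.1).unique hd⟩

theorem hasIntegralGrowth_one : HasIntegralGrowth K 1 := fun σ φ =>
  ⟨1, by simpa only [val_twistedPow, Nat.cast_one] using
    hasGrowthRate_twistedPow_of_mem_affineSubmonoid (σ := σ) (degree_le_one_of_dim_one φ)⟩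

theorem hasIntegralGrowth_two : HasIntegralGrowth K 2 := exists_hasGrowthRate_twistedPow

theorem IsSkewOver.dynamicalDegree_eq_max {f : AffineEnd K (m + c)} {g : AffineEnd K m}
    (hf : IsSkewOver f g) {L : ℝ} (hL : HasGrowthRate (fun r => (genericFibre (f ^ r)).degree) L) :
    f.dynamicalDegree = max g.dynamicalDegree L :=
  HasGrowthRate.eq_max (fun r => (hf.pow r).degree_le) (fun r => degree_genericFibre_le (f ^ r))
    (fun s r => by rw [pow_add]; exact (hf.pow s).degree_mul_le (hf.pow r))
    (hasGrowthRate_degree_pow f) (hasGrowthRate_degree_pow g) hL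

theorem IsSkewOver.exists_dynamicalDegree_eq_intCast (hbase : HasIntegralGrowth K m)
    (hfibre : HasIntegralGrowth (BaseField K m) c) {f : (AffineEnd K (m + c))ˣ}
    {g : (AffineEnd K m)ˣ} (hf : IsSkewOver f.1 g.1) : ∃ d : ℤ, f.1.dynamicalDegree = d := by
  obtain ⟨d, hd⟩ := hbase.exists_dynamicalDegree_eq_intCast g
  obtain ⟨φ, hφ⟩ := isUnit_genericFibre hf
  obtain ⟨e, he⟩ := hfibre (pullback g) φ
  simp only [hφ, ← genericFibre_pow hf] at he
  exact ⟨max d e, by rw [hf.dynamicalDegree_eq_max he, hd, Int.cast_max, Int.cast_natCast]⟩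

theorem dynamicalDegree_conj (θ f : (AffineEnd K n)ˣ) :
    (θ * f * θ⁻¹).1.dynamicalDegree = f.1.dynamicalDegree := by
  cases n with
  | zero => exact congrArg _ (AffineEnd.ext (funext fun i => i.elim0))
  | succ n =>
    have hpow (g : (AffineEnd K (n + 1))ˣ) (r : ℕ) :
        (twistedPow (Units.map (mapCoeff (RingHom.id K))) g r).1.degree = (g.1 ^ r).degree := by
      rw [val_twistedPow, mapCoeff_id, twistedPow_id]
    have hconj : IsTwistedConj (Units.map (mapCoeff (RingHom.id K))) f (θ * f * θ⁻¹) :=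
      ⟨θ, by rw [mapCoeff_id, Units.map_id, MonoidHom.id_apply]⟩
    have hgrowth := hasGrowthRate_twistedPow_of_isTwistedConj hconj
      (by simpa only [hpow] using hasGrowthRate_degree_pow (θ * f * θ⁻¹).1)
    simp only [hpow] at hgrowth
    exact hgrowth.unique (hasGrowthRate_degree_pow f.1)

end AffineEnd

section LinearProjections

open MvPolynomial

theorem exists_linearEquiv_castAdd_eq {k : Type*} [Field k] {m c : ℕ}
    {f : (Fin (m + c) → k) →ₗ[k] Fin m → k} (hf : Function.Surjective f) :
    ∃ L : (Fin (m + c) → k) ≃ₗ[k] Fin (m + c) → k, ∀ x i, L x (Fin.castAdd c i) = f x i := by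
  have hfinrank : Module.finrank k (LinearMap.ker f) = Module.finrank k (Fin c → k) := by
    have h := f.finrank_range_add_finrank_ker
    rw [LinearMap.range_eq_top.2 hf, finrank_top, Module.finrank_fin_fun,
      Module.finrank_fin_fun] at h
    rw [Module.finrank_fin_fun]
    omega
  obtain ⟨s, hs⟩ := f.exists_rightInverse_of_surjective (LinearMap.range_eq_top.2 hf)
  obtain ⟨e, -, he⟩ := f.exact_subtype_ker_map.splitSurjectiveEquiv
    (Submodule.injective_subtype _) ⟨s, hs⟩
  let L := e.trans (LinearEquiv.prodComm k _ _)
    |>.trans ((LinearEquiv.refl k _).prodCongr (LinearEquiv.ofFinrankEq _ _ hfinrank))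
    |>.trans (LinearEquiv.sumArrowLequivProdArrow (Fin m) (Fin c) k k).symm
    |>.trans (LinearEquiv.funCongrLeft k k finSumFinEquiv.symm)
  refine ⟨L, fun x i => ?_⟩
  change Sum.elim (e x).2 _ (finSumFinEquiv.symm (Fin.castAdd c i)) = _
  rw [finSumFinEquiv_symm_apply_castAdd, Sum.elim_inl]
  exact congrFun (LinearMap.congr_fun he x).symm i

theorem LinearProjection.onPoints_apply {k : Type*} [Field k] {n m : ℕ}
    (π : LinearProjection k n m) (K : Type*) [Field K] [Algebra k K] (x : Fin n → K) (i : Fin m) :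
    π.onPoints K x i = aeval x (π.matrix.toMvPolynomial i) := by
  rw [onPoints, ← Matrix.toMvPolynomial_eval_eq_apply, Matrix.toMvPolynomial_map, eval_map,
    aeval_def]

namespace AffineEnd

variable {k : Type*} [Field k] {n m c : ℕ}

/-- The linear endomorphism with a given matrix. -/
noncomputable def ofMatrix : Matrix (Fin n) (Fin n) k →* AffineEnd k n where
  toFun A := ⟨A.toMvPolynomial⟩
  map_one' := AffineEnd.ext Matrix.toMvPolynomial_one
  map_mul' A B := AffineEnd.ext (funext (Matrix.toMvPolynomial_mul A B))

theorem exists_units_onPoints_castAdd_eq (π : LinearProjection k (m + c) m) (K : Type*) [Field K]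
    [Algebra k K] : ∃ θ : (AffineEnd k (m + c))ˣ,
      ∀ x, θ.1.onPoints K x ∘ Fin.castAdd c = π.onPoints K x := by
  obtain ⟨L, hL⟩ := exists_linearEquiv_castAdd_eq (f := π.matrix.mulVecLin) π.surjective
  let A : GL (Fin (m + c)) k := Units.map LinearMap.toMatrixAlgEquiv'.toMonoidHom
    ((LinearMap.GeneralLinearGroup.generalLinearEquiv k _).symm L)
  refine ⟨Units.map ofMatrix A, fun x => funext fun i => ?_⟩
  have hrow : A.1 (Fin.castAdd c i) = π.matrix i := funext fun j =>
    (hL (Pi.single j 1) i).trans (congrFun (π.matrix.mulVec_single_one j) i)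
  have hcoord : A.1.toMvPolynomial (Fin.castAdd c i) = π.matrix.toMvPolynomial i :=
    Finset.sum_congr rfl fun j _ => by rw [hrow]
  exact (congrArg (aeval x) hcoord).trans (π.onPoints_apply K x i).symm

section OnPoints

variable (K : Type*) [Field K] [Algebra k K]

theorem onPoints_mul (f g : AffineEnd k n) (x : Fin n → K) :
    (f * g).onPoints K x = f.onPoints K (g.onPoints K x) :=
  funext fun i => by rw [onPoints, coord_mul, aeval_bind₁]; rfl

theorem onPoints_one (x : Fin n → K) : (1 : AffineEnd k n).onPoints K x = x :=
  funext fun i => by rw [onPoints, coord_one, aeval_X]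

theorem onPoints_onPoints_inv (f : (AffineEnd k n)ˣ) (x : Fin n → K) :
    f.1.onPoints K ((f⁻¹).1.onPoints K x) = x := by
  rw [← onPoints_mul, Units.mul_inv, onPoints_one]

theorem onPoints_injective (f : (AffineEnd k n)ˣ) : Function.Injective (f.1.onPoints K) :=
  Function.LeftInverse.injective (g := (f⁻¹).1.onPoints K) fun x => by
    rw [← onPoints_mul, Units.inv_mul, onPoints_one]

end OnPoints

theorem PreservesFibres.onPoints_eq_iff {f : (AffineEnd k n)ˣ} {π : LinearProjection k n m}
    (hf : f.1.PreservesFibres π) {x y : Fin n → AlgebraicClosure k} :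
    π.onPoints _ (f.1.onPoints _ x) = π.onPoints _ (f.1.onPoints _ y) ↔
      π.onPoints _ x = π.onPoints _ y := by
  obtain ⟨t, ht⟩ := hf _ ⟨π.onPoints _ x, rfl⟩
  have hfibre (z) : π.onPoints _ (f.1.onPoints (AlgebraicClosure k) z) = t ↔
      π.onPoints _ z = π.onPoints _ x :=
    (Set.ext_iff.1 ht _).trans (onPoints_injective _ f).mem_set_image
  rw [(hfibre x).2 rfl, eq_comm, hfibre y, eq_comm]

theorem exists_isSkewOver_of_onPoints {f : AffineEnd k (m + c)} (K : Type*) [Field K] [Infinite K]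
    [Algebra k K] (hf : ∀ x y, x ∘ Fin.castAdd c = y ∘ Fin.castAdd c →
      f.onPoints K x ∘ Fin.castAdd c = f.onPoints K y ∘ Fin.castAdd c) :
    ∃ g : AffineEnd k m, IsSkewOver f g := by
  refine ⟨⟨fun i => bind₁ (Fin.append X 0) (f.coord (Fin.castAdd c i))⟩, fun i =>
    map_injective _ (algebraMap k K).injective (MvPolynomial.funext fun x => ?_)⟩
  let x₀ : Fin (m + c) → K := Fin.append (x ∘ Fin.castAdd c) 0
  have hx₀ : (fun j => aeval (x ∘ Fin.castAdd c) (Fin.append X 0 j : MvPolynomial (Fin m) k)) =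
      x₀ := funext fun j => by
    induction j using Fin.addCases with
    | left j => simp only [x₀, Fin.append_left, aeval_X]
    | right j => simp only [x₀, Fin.append_right, Pi.zero_apply, map_zero]
  have heq : aeval x (f.coord (Fin.castAdd c i)) = aeval x₀ (f.coord (Fin.castAdd c i)) :=
    congrFun (hf x x₀ (funext fun j => (Fin.append_left _ _ j).symm)) i
  rw [eval_map, eval_map, ← aeval_def, ← aeval_def, aeval_rename, aeval_bind₁, hx₀, heq]

theorem exists_units_isSkewOver_of_onPoints {f : (AffineEnd k (m + c))ˣ} (K : Type*) [Field K]
    [Infinite K] [Algebra k K] (hf : ∀ x y,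
      f.1.onPoints K x ∘ Fin.castAdd c = f.1.onPoints K y ∘ Fin.castAdd c ↔
        x ∘ Fin.castAdd c = y ∘ Fin.castAdd c) :
    ∃ g : (AffineEnd k m)ˣ, IsSkewOver f.1 g.1 := by
  obtain ⟨g, hg⟩ := exists_isSkewOver_of_onPoints K fun x y => (hf x y).2
  obtain ⟨g', hg'⟩ := exists_isSkewOver_of_onPoints (f := (f⁻¹).1) K fun x y hxy =>
    (hf _ _).1 (by rwa [onPoints_onPoints_inv, onPoints_onPoints_inv])
  have hgg' := hg.mul hg'
  have hg'g := hg'.mul hg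
  rw [Units.mul_inv] at hgg'
  rw [Units.inv_mul] at hg'g
  exact ⟨⟨g, g', hgg'.unique .one, hg'g.unique .one⟩, hg⟩

theorem PreservesFibres.exists_isSkewOver_conj {f : (AffineEnd k (m + c))ˣ}
    {π : LinearProjection k (m + c) m} (hf : f.1.PreservesFibres π) :
    ∃ (θ : (AffineEnd k (m + c))ˣ) (g : (AffineEnd k m)ˣ), IsSkewOver (θ * f * θ⁻¹).1 g.1 := by
  obtain ⟨θ, hθ⟩ := exists_units_onPoints_castAdd_eq π (AlgebraicClosure k)
  refine ⟨θ, exists_units_isSkewOver_of_onPoints (AlgebraicClosure k) fun x y => ?_⟩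
  rw [Units.val_mul, Units.val_mul, onPoints_mul, onPoints_mul, onPoints_mul, onPoints_mul, hθ, hθ,
    hf.onPoints_eq_iff, ← hθ, ← hθ, onPoints_onPoints_inv, onPoints_onPoints_inv]

theorem PreservesFibres.exists_dynamicalDegree_eq_intCast (hbase : HasIntegralGrowth k m)
    (hfibre : HasIntegralGrowth (BaseField k m) c) {f : (AffineEnd k (m + c))ˣ}
    {π : LinearProjection k (m + c) m} (hf : f.1.PreservesFibres π) :
    ∃ d : ℤ, f.1.dynamicalDegree = d := by
  obtain ⟨θ, g, hg⟩ := hf.exists_isSkewOver_conj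
  rw [← dynamicalDegree_conj θ f]
  exact hg.exists_dynamicalDegree_eq_intCast hbase hfibre

end AffineEnd

end LinearProjections

theorem mainTheorem8 (k : Type*) [Field k] :
    (∀ f : (AffineEnd k 2)ˣ, ∃ d : ℤ, (f : AffineEnd k 2).dynamicalDegree = (d : ℝ)) ∧
    (∀ f : (AffineEnd k 3)ˣ,
      ((∃ π : LinearProjection k 3 1, (f : AffineEnd k 3).PreservesFibres π) ∨
        (∃ π : LinearProjection k 3 2, (f : AffineEnd k 3).PreservesFibres π)) →
      ∃ d : ℤ, (f : AffineEnd k 3).dynamicalDegree = (d : ℝ)) ∧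
    (∀ f : (AffineEnd k 4)ˣ,
      (∃ π : LinearProjection k 4 2, (f : AffineEnd k 4).PreservesFibres π) →
      ∃ d : ℤ, (f : AffineEnd k 4).dynamicalDegree = (d : ℝ)) := by
  refine ⟨AffineEnd.hasIntegralGrowth_two.exists_dynamicalDegree_eq_intCast, ?_, ?_⟩
  · rintro f (⟨π, hπ⟩ | ⟨π, hπ⟩)
    · exact hπ.exists_dynamicalDegree_eq_intCast (m := 1) AffineEnd.hasIntegralGrowth_one
        AffineEnd.hasIntegralGrowth_two
    · exact hπ.exists_dynamicalDegree_eq_intCast (m := 2) AffineEnd.hasIntegralGrowth_two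
        AffineEnd.hasIntegralGrowth_one
  · rintro f ⟨π, hπ⟩
    exact hπ.exists_dynamicalDegree_eq_intCast (m := 2) AffineEnd.hasIntegralGrowth_two
      AffineEnd.hasIntegralGrowth_two
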